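/- **Setting.** Let $U=U_T\cdots U_1$ be a quantum circuit on $n+r\ge 1$ qubits ($n$ input qubits, $r$ work qubits; the first qubit is the output qubit) consisting of arbitrary single-qubit unitary gates and $T_2\ge 0$ gates $CZ$, where for some integer $L\ge 3$ the $CZ$ gates are applied exactly at the times $L,2L,\dots,T_2L$, with $T\ge T_2L+3$ if $T_2\ge 1$. Suppose that each $CZ$ gate is conjugated by $Z$ gates: at the two times immediately before it, and again at the two times immediately after it, a $Z$ gate is applied to each of its two qubits (in either order). Let $x\in\{0,1\}^n$, let $y=(x,0^r)\in\{0,1\}^{n+r}$, let $M>L$ be an integer, put $N=T+M$, and let $V=V_N\cdots V_1$ be the pre-idled circuit, $V_t=I$ for $t\le M$ and $V_t=U_{t-M}$ for $t>M$. Let $\mathcal T_1=\{1,\dots,N\}\setminus\{L+M,2L+M,\dots,T_2L+M\}$, and let $f_t\neq s_t$ be the two qubits on which $CZ$ acts at time $t=lL+M$. On the $n+r$ computation qubits together with $N$ clock qubits numbered $1,\dots,N$ define (operators to the right of $\otimes$ act on the clock, subscripts denote qubits, identities are omitted where clear, and $|ab\rangle\langle cd|_{i,j}$ acts on clock qubits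 $i,j$) $$H_{\rm in}=\sum_{i}|\bar y_i\rangle\langle \bar y_i|_i\otimes|0\rangle\langle0|_1,\qquad H_{\rm out}=|0\rangle\langle0|_{\rm out}\otimes|1\rangle\langle1|_N,\qquad H_{\rm clock}=\sum_{j=1}^{N-1}I\otimes|01\rangle\langle01|_{j,j+1},$$ where $\bar y_i=1-y_i$, $$H_{\rm prop1}=\sum_{t\in\mathcal T_1}H_{{\rm prop},t},\qquad H_{{\rm prop},t}=\tfrac12\big(I\otimes|10\rangle\langle10|_{t,t+1}+I\otimes|10\rangle\langle10|_{t-1,t}-V_t\otimes|1\rangle\langle0|_t-V_t^\dagger\otimes|0\rangle\langle1|_t\big),$$ where for $t=1$ the term $|10\rangle\langle10|_{t-1,t}$ is replaced by $|0\rangle\langle0|_1$ and for $t=N$ the term $|10\rangle\langle10|_{t,t+1}$ is replaced by $|1\rangle\langle1|_N$, and $$H_{\rm prop2}=\sum_{l=1}^{T_2}\big(H_{{\rm qubit},lL+M}+H_{{\rm time},lL+M}\big),$$ $$H_{{\rm qubit},t}=\tfrac12\big(-2|0\rangle\langle0|_{f_t}-2|0\rangle\langle0|_{s_t}+|1\rangle\langle1|_{f_t}+|1\rangle\langle1|_{s_t}\big)\otimes\big(|1\rangle\langle0|_t+|0\rangle\langle1|_t\big),$$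 $$\begin{aligned}H_{{\rm time},t}=\tfrac18\, I\otimes\big(&|10\rangle\langle10|_{t,t+1}+6|10\rangle\langle10|_{t+1,t+2}+|10\rangle\langle10|_{t+2,t+3}+2|11\rangle\langle00|_{t+1,t+2}+2|00\rangle\langle11|_{t+1,t+2}\\&+X_{t+1}+X_{t+2}+|10\rangle\langle10|_{t-3,t-2}+6|10\rangle\langle10|_{t-2,t-1}+|10\rangle\langle10|_{t-1,t}\\&+2|11\rangle\langle00|_{t-2,t-1}+2|00\rangle\langle11|_{t-2,t-1}+X_{t-2}+X_{t-1}\big),\end{aligned}$$ with $X_i=|1\rangle\langle0|_i+|0\rangle\langle1|_i$. For real $J_{\rm in},J_2,J_1,J_{\rm clock}$ let $$H=J_{\rm in}H_{\rm in}+J_{\rm clock}H_{\rm clock}+J_1H_{\rm prop1}+J_2H_{\rm prop2}+(T+M)H_{\rm out}.$$ This is a 2-local Hermitian operator. Denote by $\lambda_0(H)\le\lambda_1(H)\le\cdots$ its eigenvalues with multiplicity, and by $\|\cdot\|$ the operator norm. **Claim.** There are real polynomials $p_{\rm in},p_2,p_1,p_{\rm clock}$ in one variable (absolute, i.e. independent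 of everything else) such that, for all $n,r,U,x,M$ as above and all real $\Delta,J_{\rm in},J_2,J_1,J_{\rm clock}$ with $$\begin{aligned}J_{\rm in}&\ge p_{\rm in}\big(\|H_{\rm out}\|(T+M)\big)\,\Delta,\\ J_2&\ge p_2\big(\|H_{\rm out}+J_{\rm in}H_{\rm in}\|\,T\big)\,\Delta,\\ J_1&\ge p_1\big(\|H_{\rm out}+J_{\rm in}H_{\rm in}+J_2H_{\rm prop2}\|\,M\big)\,\Delta,\\ J_{\rm clock}&\ge p_{\rm clock}\big(\|H_{\rm out}+J_{\rm in}H_{\rm in}+J_2H_{\rm prop2}+J_1H_{\rm prop1}\|\big)\,\Delta,\end{aligned}$$ the spectral gap satisfies $\gamma(H)=\lambda_1(H)-\lambda_0(H)\ge\Delta-2$. -/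

import Mathlib

open scoped Kronecker

noncomputable section

namespace TwoLocal

/-- Operators on the Hilbert space of `k` qubits, as matrices in the computational basis. -/
abbrev QubitOp (k : ℕ) : Type := Matrix (Fin k → Fin 2) (Fin k → Fin 2) ℂ

/-- The operator `|a⟩⟨b|` on one qubit. -/
def ketbra (a b : Fin 2) : Matrix (Fin 2) (Fin 2) ℂ := Matrix.single a b 1

/-- The Pauli matrix `Z`. -/
def pauliZ : Matrix (Fin 2) (Fin 2) ℂ := ketbra 0 0 - ketbra 1 1

/-- The one-qubit operator `G` acting on qubit `i` of `k` qubits (tensored with identities). -/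
def onQubit {k : ℕ} (i : Fin k) (G : Matrix (Fin 2) (Fin 2) ℂ) : QubitOp k :=
  fun a b => if ∀ j, j ≠ i → a j = b j then G (a i) (b i) else 0

/-- The one-qubit operator `G` acting on the clock qubit number `j`, where the `N` clock qubits are
numbered `1, …, N` (other values of `j` never occur below). -/
def onClock (N : ℕ) (G : Matrix (Fin 2) (Fin 2) ℂ) (j : ℕ) : QubitOp N :=
  if h : 1 ≤ j ∧ j ≤ N then onQubit ⟨j - 1, by omega⟩ G else 0

/-- The operator `|a b⟩⟨c d|` on the two distinct clock qubits `i, j`. -/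
def clockPair (N : ℕ) (a b c d : Fin 2) (i j : ℕ) : QubitOp N :=
  onClock N (ketbra a c) i * onClock N (ketbra b d) j

/-- The projector `|10⟩⟨10|` on clock qubits `i, j`. -/
def proj10 (N : ℕ) (i j : ℕ) : QubitOp N := clockPair N 1 0 1 0 i j

/-- A circuit `U = U_T ⋯ U_1` on `m` qubits made of single-qubit gates and `CZ` gates.
There are `T₂` gates `CZ`, at the times `L, 2L, …, T₂ L`; the `l`-th one acts on the qubits
`fst l ≠ snd l`. At any other time `1 ≤ t ≤ T` the gate is the single-qubit gate `gate t`
on qubit `qubit t` (the values of `gate` and `qubit` at other arguments are irrelevant).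
Immediately before and immediately after each `CZ` gate, two `Z` gates are applied, one on each of
its two qubits, in either order. -/
structure Circuit (m : ℕ) where
  qubits_pos : 0 < m
  T : ℕ
  L : ℕ
  T₂ : ℕ
  qubit : ℕ → Fin m
  gate : ℕ → Matrix.unitaryGroup (Fin 2) ℂ
  fst : ℕ → Fin m
  snd : ℕ → Fin m
  three_le_L : 3 ≤ L
  le_T : 0 < T₂ → T₂ * L + 3 ≤ T
  fst_ne_snd : ∀ l ∈ Finset.Icc 1 T₂, fst l ≠ snd l
  gate_before : ∀ l ∈ Finset.Icc 1 T₂,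
    (gate (l * L - 2) : Matrix (Fin 2) (Fin 2) ℂ) = pauliZ ∧
      (gate (l * L - 1) : Matrix (Fin 2) (Fin 2) ℂ) = pauliZ
  qubit_before : ∀ l ∈ Finset.Icc 1 T₂,
    (qubit (l * L - 2) = fst l ∧ qubit (l * L - 1) = snd l) ∨
      (qubit (l * L - 2) = snd l ∧ qubit (l * L - 1) = fst l)
  gate_after : ∀ l ∈ Finset.Icc 1 T₂,
    (gate (l * L + 1) : Matrix (Fin 2) (Fin 2) ℂ) = pauliZ ∧
      (gate (l * L + 2) : Matrix (Fin 2) (Fin 2) ℂ) = pauliZ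
  qubit_after : ∀ l ∈ Finset.Icc 1 T₂,
    (qubit (l * L + 1) = fst l ∧ qubit (l * L + 2) = snd l) ∨
      (qubit (l * L + 1) = snd l ∧ qubit (l * L + 2) = fst l)

/-- Operators on `m` computation qubits together with `N` clock qubits. -/
abbrev JointOp (m N : ℕ) : Type :=
  Matrix ((Fin m → Fin 2) × (Fin N → Fin 2)) ((Fin m → Fin 2) × (Fin N → Fin 2)) ℂ

namespace Circuit

variable {m : ℕ} (U : Circuit m) (M : ℕ)

/-- The output qubit: the first one. -/
def out : Fin m := ⟨0, U.qubits_pos⟩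

/-- The times in `{1, …, T + M}` at which the pre-idled circuit `V = U I_M ⋯ I_1` applies a
single-qubit gate, i.e. all except `L + M, 2L + M, …, T₂ L + M`. -/
def singleTimes : Finset ℕ :=
  Finset.Icc 1 (U.T + M) \ (Finset.Icc 1 U.T₂).image (fun l => l * U.L + M)

/-- The gate of the pre-idled circuit at a time `t ∈ singleTimes`: the identity for `t ≤ M`,
and afterwards the gate of `U` at time `t - M`. -/
def idledGate (t : ℕ) : QubitOp m :=
  if t ≤ M then 1 else onQubit (U.qubit (t - M)) (U.gate (t - M) : Matrix (Fin 2) (Fin 2) ℂ)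

/-- `H_in`: at clock time `0`, each computation qubit `i` which is not in the state `y i` of the
initial basis state `|y⟩` gets an energy penalty. -/
def Hin (y : Fin m → Fin 2) : JointOp m (U.T + M) :=
  ∑ i, onQubit i (ketbra (1 - y i) (1 - y i)) ⊗ₖ onClock (U.T + M) (ketbra 0 0) 1

/-- `H_out`: penalizes the outcome `0` on the output qubit at the last clock time. -/
def Hout : JointOp m (U.T + M) :=
  onQubit U.out (ketbra 0 0) ⊗ₖ onClock (U.T + M) (ketbra 1 1) (U.T + M)

/-- `H_clock`: penalizes `01` on consecutive clock qubits. -/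
def Hclock : JointOp m (U.T + M) :=
  ∑ j ∈ Finset.Icc 1 (U.T + M - 1), (1 : QubitOp m) ⊗ₖ clockPair (U.T + M) 0 1 0 1 j (j + 1)

/-- `H_{prop,t}` for a single-qubit gate; at the first time `|10⟩⟨10|_{t-1,t}` is replaced by
`|0⟩⟨0|_1`, and at the last time `|10⟩⟨10|_{t,t+1}` is replaced by `|1⟩⟨1|_{T+M}`. -/
def HpropAt (t : ℕ) : JointOp m (U.T + M) :=
  (1 / 2 : ℝ) •
    ((1 : QubitOp m) ⊗ₖ
        (if t = U.T + M then onClock (U.T + M) (ketbra 1 1) t else proj10 (U.T + M) t (t + 1))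
      + (1 : QubitOp m) ⊗ₖ
        (if t = 1 then onClock (U.T + M) (ketbra 0 0) t else proj10 (U.T + M) (t - 1) t)
      - U.idledGate M t ⊗ₖ onClock (U.T + M) (ketbra 1 0) t
      - (U.idledGate M t).conjTranspose ⊗ₖ onClock (U.T + M) (ketbra 0 1) t)

def Hprop1 : JointOp m (U.T + M) := ∑ t ∈ U.singleTimes M, U.HpropAt M t

/-- `H_{qubit,t}` at the time `t = lL + M` of the `l`-th `CZ` gate. -/
def Hqubit (l : ℕ) : JointOp m (U.T + M) :=
  let t := l * U.L + M
  (1 / 2 : ℝ) •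
    (((-2 : ℝ) • onQubit (U.fst l) (ketbra 0 0) + (-2 : ℝ) • onQubit (U.snd l) (ketbra 0 0)
        + onQubit (U.fst l) (ketbra 1 1) + onQubit (U.snd l) (ketbra 1 1)) ⊗ₖ
      (onClock (U.T + M) (ketbra 1 0) t + onClock (U.T + M) (ketbra 0 1) t))

/-- `|1⟩⟨0| + |0⟩⟨1|` on clock qubit `i`. -/
def clockFlip (N : ℕ) (i : ℕ) : QubitOp N := onClock N (ketbra 1 0) i + onClock N (ketbra 0 1) i

/-- `|11⟩⟨00| + |00⟩⟨11|` on clock qubits `i, j`. -/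
def clockDoubleFlip (N : ℕ) (i j : ℕ) : QubitOp N :=
  clockPair N 1 1 0 0 i j + clockPair N 0 0 1 1 i j

/-- `H_{time,t}` at the time `t = lL + M` of the `l`-th `CZ` gate. -/
def Htime (l : ℕ) : JointOp m (U.T + M) :=
  let t := l * U.L + M
  let N := U.T + M
  (1 / 8 : ℝ) • ((1 : QubitOp m) ⊗ₖ
    (proj10 N t (t + 1) + (6 : ℝ) • proj10 N (t + 1) (t + 2) + proj10 N (t + 2) (t + 3)
      + (2 : ℝ) • clockDoubleFlip N (t + 1) (t + 2)
      + clockFlip N (t + 1) + clockFlip N (t + 2)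
      + proj10 N (t - 3) (t - 2) + (6 : ℝ) • proj10 N (t - 2) (t - 1) + proj10 N (t - 1) t
      + (2 : ℝ) • clockDoubleFlip N (t - 2) (t - 1)
      + clockFlip N (t - 2) + clockFlip N (t - 1)))

def Hprop2 : JointOp m (U.T + M) := ∑ l ∈ Finset.Icc 1 U.T₂, (U.Hqubit M l + U.Htime M l)

/-- The 2-local Hamiltonian
`J_in H_in + J_clock H_clock + J₁ H_prop1 + J₂ H_prop2 + (T + M) H_out`. -/
def hamiltonian (y : Fin m → Fin 2) (Jin Jclock J₁ J₂ : ℝ) : JointOp m (U.T + M) :=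
  Jin • U.Hin M y + Jclock • U.Hclock M + J₁ • U.Hprop1 M + J₂ • U.Hprop2 M
    + ((U.T + M : ℕ) : ℝ) • U.Hout M

end Circuit

/-- The initial basis state: input `x` in the first register, zeros in the work register. -/
def initialBits {n : ℕ} (r : ℕ) (x : Fin n → Fin 2) : Fin (n + r) → Fin 2 :=
  Fin.append x (fun _ => 0)

/-- The operator norm with respect to the Euclidean (Hilbert space) norm. -/
def opNorm {ι : Type*} [Fintype ι] [DecidableEq ι] (A : Matrix ι ι ℂ) : ℝ :=
  ‖Matrix.toEuclideanCLM (𝕜 := ℂ) A‖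

/-- `λ_k(A)`: the `k`-th eigenvalue of a Hermitian matrix, counted with multiplicity in
non-decreasing order and starting with `k = 0` (`eigenvalues₀` is in non-increasing order).
The value is `0` if `k` is not less than the dimension. -/
def eigenvalueAt {ι : Type*} [Fintype ι] [DecidableEq ι] {A : Matrix ι ι ℂ}
    (hA : A.IsHermitian) (k : ℕ) : ℝ :=
  if h : k < Fintype.card ι then hA.eigenvalues₀ (Fin.rev ⟨k, h⟩) else 0

/-- The spectral gap `λ₁(A) - λ₀(A)`. -/
def spectralGap {ι : Type*} [Fintype ι] [DecidableEq ι] {A : Matrix ι ι ℂ}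
    (hA : A.IsHermitian) : ℝ :=
  eigenvalueAt hA 1 - eigenvalueAt hA 0

/-! The Hamiltonian is Hermitian. -/

theorem ketbra_conjTranspose (a b : Fin 2) : (ketbra a b).conjTranspose = ketbra b a := by
  simp [ketbra, Matrix.conjTranspose_single]

theorem onQubit_conjTranspose {k : ℕ} (i : Fin k) (G : Matrix (Fin 2) (Fin 2) ℂ) :
    (onQubit i G).conjTranspose = onQubit i G.conjTranspose := by
  ext a b
  have h : (∀ j, j ≠ i → b j = a j) ↔ (∀ j, j ≠ i → a j = b j) :=
    ⟨fun h j hj => (h j hj).symm, fun h j hj => (h j hj).symm⟩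
  simp only [Matrix.conjTranspose_apply, onQubit, h]
  split_ifs <;> simp

theorem onClock_conjTranspose (N : ℕ) (G : Matrix (Fin 2) (Fin 2) ℂ) (j : ℕ) :
    (onClock N G j).conjTranspose = onClock N G.conjTranspose j := by
  unfold onClock
  split_ifs
  · exact onQubit_conjTranspose _ _
  · simp

theorem onQubit_mul_apply {k : ℕ} {i j : Fin k} (hij : i ≠ j) (A B : Matrix (Fin 2) (Fin 2) ℂ)
    (a b : Fin k → Fin 2) :
    (onQubit i A * onQubit j B) a b =
      if ∀ q, q ≠ i → q ≠ j → a q = b q then A (a i) (b i) * B (a j) (b j) else 0 := by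
  rw [Matrix.mul_apply, Finset.sum_eq_single (Function.update a i (b i))]
  · have h1 : ∀ q, q ≠ i → a q = Function.update a i (b i) q := by
      intro q hq; simp [hq]
    have h2 : (∀ q, q ≠ j → Function.update a i (b i) q = b q) ↔
        ∀ q, q ≠ i → q ≠ j → a q = b q := by
      constructor
      · intro h q hqi hqj
        simpa [hqi] using h q hqj
      · intro h q hqj
        by_cases hqi : q = i
        · subst hqi; simp
        · simpa [hqi] using h q hqi hqj
    simp only [onQubit, if_pos h1, h2]
    split_ifs <;> simp [hij.symm]
  · intro c _ hc
    simp only [onQubit]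
    by_cases h1 : ∀ q, q ≠ i → a q = c q
    · have h2 : ¬ ∀ q, q ≠ j → c q = b q := by
        intro h2
        apply hc
        funext q
        by_cases hq : q = i
        · subst hq; simpa using h2 q hij
        · simp [hq, h1 q hq]
      simp [h2]
    · simp [h1]
  · intro h; exact absurd (Finset.mem_univ _) h

theorem onQubit_comm {k : ℕ} {i j : Fin k} (hij : i ≠ j) (A B : Matrix (Fin 2) (Fin 2) ℂ) :
    onQubit i A * onQubit j B = onQubit j B * onQubit i A := by
  ext a b
  rw [onQubit_mul_apply hij, onQubit_mul_apply hij.symm, mul_comm]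
  congr 1
  exact propext ⟨fun h q h1 h2 => h q h2 h1, fun h q h1 h2 => h q h2 h1⟩

theorem clockPair_conjTranspose (N : ℕ) (a b c d : Fin 2) {i j : ℕ} (hij : i ≠ j) :
    (clockPair N a b c d i j).conjTranspose = clockPair N c d a b i j := by
  simp only [clockPair, Matrix.conjTranspose_mul, onClock_conjTranspose, ketbra_conjTranspose]
  unfold onClock
  split_ifs with h1 h2
  · exact onQubit_comm (by intro h; simp only [Fin.mk.injEq] at h; omega) _ _
  all_goals simp

namespace Circuit

variable {m : ℕ} (U : Circuit m) (M : ℕ)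

theorem hamiltonian_isHermitian (y : Fin m → Fin 2) (Jin Jclock J₁ J₂ : ℝ) :
    (U.hamiltonian M y Jin Jclock J₁ J₂).IsHermitian := by
  have hs : ∀ {A : JointOp m (U.T + M)} (c : ℝ), A.IsHermitian → (c • A).IsHermitian := by
    intro A c hA
    simp [Matrix.IsHermitian, Matrix.conjTranspose_smul, hA.eq]
  have hsum : ∀ (s : Finset ℕ) (A : ℕ → JointOp m (U.T + M)),
      (∀ i ∈ s, (A i).IsHermitian) → (∑ i ∈ s, A i).IsHermitian := by
    intro s A h
    simp only [Matrix.IsHermitian, Matrix.conjTranspose_sum]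
    exact Finset.sum_congr rfl h
  have hin : (U.Hin M y).IsHermitian := by
    simp [Matrix.IsHermitian, Hin, Matrix.conjTranspose_sum, Matrix.conjTranspose_kronecker,
      onQubit_conjTranspose, onClock_conjTranspose, ketbra_conjTranspose]
  have hout : (U.Hout M).IsHermitian := by
    simp [Matrix.IsHermitian, Hout, Matrix.conjTranspose_kronecker,
      onQubit_conjTranspose, onClock_conjTranspose, ketbra_conjTranspose]
  have hclock : (U.Hclock M).IsHermitian := by
    refine hsum _ _ fun j _ => ?_
    simp [Matrix.IsHermitian, Matrix.conjTranspose_kronecker,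
      clockPair_conjTranspose _ _ _ _ _ (show j ≠ j + 1 by omega)]
  have hprop1 : (U.Hprop1 M).IsHermitian := by
    refine hsum _ _ fun t ht => hs _ ?_
    have ht1 : 1 ≤ t := by
      simp only [singleTimes, Finset.mem_sdiff, Finset.mem_Icc] at ht
      exact ht.1.1
    have e1 : (if t = U.T + M then onClock (U.T + M) (ketbra 1 1) t
        else proj10 (U.T + M) t (t + 1)).conjTranspose = (if t = U.T + M then
          onClock (U.T + M) (ketbra 1 1) t else proj10 (U.T + M) t (t + 1)) := by
      split_ifs
      · simp [onClock_conjTranspose, ketbra_conjTranspose]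
      · exact clockPair_conjTranspose _ _ _ _ _ (by omega)
    have e2 : (if t = 1 then onClock (U.T + M) (ketbra 0 0) t
        else proj10 (U.T + M) (t - 1) t).conjTranspose = (if t = 1 then
          onClock (U.T + M) (ketbra 0 0) t else proj10 (U.T + M) (t - 1) t) := by
      split_ifs
      · simp [onClock_conjTranspose, ketbra_conjTranspose]
      · exact clockPair_conjTranspose _ _ _ _ _ (by omega)
    simp only [Matrix.IsHermitian, Matrix.conjTranspose_sub, Matrix.conjTranspose_add,
      Matrix.conjTranspose_kronecker, Matrix.conjTranspose_one, e1, e2, onClock_conjTranspose,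
      ketbra_conjTranspose, Matrix.conjTranspose_conjTranspose]
    abel
  have hprop2 : (U.Hprop2 M).IsHermitian := by
    refine hsum _ _ fun l hl => Matrix.IsHermitian.add (hs _ ?_) (hs _ ?_)
    · simp [Matrix.IsHermitian, Matrix.conjTranspose_kronecker, Matrix.conjTranspose_smul,
        onQubit_conjTranspose, onClock_conjTranspose, ketbra_conjTranspose, add_comm]
    · have hl1 : 1 ≤ l := (Finset.mem_Icc.mp hl).1
      have h3 := U.three_le_L
      have ht : 3 ≤ l * U.L + M := le_trans (by nlinarith) (Nat.le_add_right _ _)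
      generalize l * U.L + M = t at ht ⊢
      have hf : ∀ i, (clockFlip (U.T + M) i).conjTranspose = clockFlip (U.T + M) i := by
        intro i
        simp [clockFlip, onClock_conjTranspose, ketbra_conjTranspose, add_comm]
      have hd : ∀ {i j : ℕ}, i ≠ j →
          (clockDoubleFlip (U.T + M) i j).conjTranspose = clockDoubleFlip (U.T + M) i j := by
        intro i j hij
        simp [clockDoubleFlip, clockPair_conjTranspose _ _ _ _ _ hij, add_comm]
      have hp : ∀ {i j : ℕ}, i ≠ j →
          (proj10 (U.T + M) i j).conjTranspose = proj10 (U.T + M) i j :=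
        fun hij => clockPair_conjTranspose _ _ _ _ _ hij
      simp only [Matrix.IsHermitian, Matrix.conjTranspose_kronecker, Matrix.conjTranspose_one,
        Matrix.conjTranspose_add, Matrix.conjTranspose_smul, hf, star_trivial]
      rw [hp (show t ≠ t + 1 by omega), hp (show t + 1 ≠ t + 2 by omega),
        hp (show t + 2 ≠ t + 3 by omega), hp (show t - 3 ≠ t - 2 by omega),
        hp (show t - 2 ≠ t - 1 by omega), hp (show t - 1 ≠ t by omega),
        hd (show t + 1 ≠ t + 2 by omega), hd (show t - 2 ≠ t - 1 by omega)]
  exact ((((hs _ hin).add (hs _ hclock)).add (hs _ hprop1)).add (hs _ hprop2)).add (hs _ hout)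

end Circuit

end TwoLocal

end

/-! By the variational principle (`le_spectralGap`) it suffices to find a vector with Rayleigh
quotient at most `1` on whose orthogonal complement the quotient is at least `Δ - 1`. The vector is
the history state, the sum over `t` of `V_t ⋯ V_1 |y⟩ ⊗ |1^t 0^(N-t)⟩`. Every term except `H_out`
has zero energy on it, and `N H_out` contributes at most `N` against a squared norm of `N + 1`.

A vector orthogonal to the history is split into its part on legal (unary) clock strings and a rest
`w`. The clock term costs at least `‖w‖²`. The cross terms between the two parts are absorbed by
Young's inequality (`energy_add_vec_ge`), at the price of half the squared norm of the legal part
and of a multiple of `‖w‖²` that `Jclock` pays for.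

On legal states, passing to the frame that moves with the computation turns the propagation defects
into differences along a path with `N + 1` vertices, one path for each basis state of the
computation. Orthogonality to the history makes the `y` coordinate have mean zero, and `H_in`
penalizes every other coordinate at time zero. A Poincaré inequality then gives the gap
(`path_gap`).

The delicate term is `H_prop2`, which is indefinite. It acts like a penalty on the `CZ` steps only
where the neighbouring `Z` steps are respected: there `H_time / J₂` turns into the weights `2`,
`1/2`, `1` on the bits `00`, `01` or `10`, and `11`, which together with `H_qubit` complete to the
squares `2(d - c)²`, `(d - c)²/2`, `(d + c)²`. Violations of the `Z` steps are charged to `J₁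
H_prop1` through Young's inequality with a free parameter `Λ` (`czForm_ge`, `energy_cz_ge`), which
costs another half of the squared norm (`energy_legal_ge`). The two halves make up the loss from `Δ`
to `Δ - 1`.

Finally, the hypotheses speak of operator norms where the argument needs bounds in `N`, `Jin` and
`J₂`. Basis states at a single clock time show that the norms dominate these quantities up to
constants (`one_le_opNorm_Hout`, `Jin_le_opNorm`, `J₂_le_opNorm`). -/

namespace TwoLocal

open Matrix

/-! ### Quadratic forms and a variational bound for the gap. -/

noncomputable section LinearAlgebra

variable {ι : Type*} [Fintype ι]

/-- The squared Euclidean norm. -/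
def sqNorm (v : ι → ℂ) : ℝ := ∑ i, ‖v i‖ ^ 2

/-- The expectation `⟨v|A|v⟩` (its real part). -/
def energy (A : Matrix ι ι ℂ) (v : ι → ℂ) : ℝ := (star v ⬝ᵥ A *ᵥ v).re

theorem sqNorm_nonneg (v : ι → ℂ) : 0 ≤ sqNorm v :=
  Finset.sum_nonneg fun _ _ => sq_nonneg _

theorem sqNorm_eq_norm (v : ι → ℂ) : sqNorm v = ‖WithLp.toLp 2 v‖ ^ 2 := by
  rw [EuclideanSpace.norm_sq_eq]; rfl

theorem dotProduct_star_self (v : ι → ℂ) : star v ⬝ᵥ v = (sqNorm v : ℂ) := by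
  simp only [dotProduct, sqNorm, Pi.star_apply, Complex.ofReal_sum]
  refine Finset.sum_congr rfl fun i _ => ?_
  rw [RCLike.star_def, ← Complex.normSq_eq_conj_mul_self, Complex.normSq_eq_norm_sq]

theorem energy_add (A B : Matrix ι ι ℂ) (v : ι → ℂ) :
    energy (A + B) v = energy A v + energy B v := by
  simp [energy, add_mulVec, dotProduct_add]

theorem energy_smul (c : ℝ) (A : Matrix ι ι ℂ) (v : ι → ℂ) :
    energy (c • A) v = c * energy A v := by
  simp [energy, smul_mulVec, dotProduct_smul]

theorem energy_sum {κ : Type*} (s : Finset κ) (A : κ → Matrix ι ι ℂ) (v : ι → ℂ) :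
    energy (∑ k ∈ s, A k) v = ∑ k ∈ s, energy (A k) v := by
  classical
  induction s using Finset.induction_on with
  | empty => simp [energy]
  | insert k s hk ih => rw [Finset.sum_insert hk, Finset.sum_insert hk, energy_add, ih]

variable [DecidableEq ι]

theorem energy_diagonal (d : ι → ℝ) (v : ι → ℂ) :
    energy (diagonal fun i => (d i : ℂ)) v = ∑ i, d i * ‖v i‖ ^ 2 := by
  simp only [energy, dotProduct, mulVec_diagonal, Pi.star_apply, Complex.re_sum]
  refine Finset.sum_congr rfl fun i _ => ?_
  rw [mul_left_comm, RCLike.star_def, ← Complex.normSq_eq_conj_mul_self,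
    Complex.normSq_eq_norm_sq, ← Complex.ofReal_mul, Complex.ofReal_re]

theorem norm_dotProduct_mulVec_le (A : Matrix ι ι ℂ) (v w : ι → ℂ) :
    ‖star v ⬝ᵥ A *ᵥ w‖ ≤ opNorm A * (‖WithLp.toLp 2 v‖ * ‖WithLp.toLp 2 w‖) := by
  have h : star v ⬝ᵥ A *ᵥ w =
      inner ℂ (WithLp.toLp 2 v) (toEuclideanCLM (𝕜 := ℂ) A (WithLp.toLp 2 w)) := by
    rw [EuclideanSpace.inner_eq_star_dotProduct, dotProduct_comm]
    simp
  rw [h]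
  calc _ ≤ ‖WithLp.toLp 2 v‖ * ‖toEuclideanCLM (𝕜 := ℂ) A (WithLp.toLp 2 w)‖ :=
        norm_inner_le_norm _ _
    _ ≤ ‖WithLp.toLp 2 v‖ * (opNorm A * ‖WithLp.toLp 2 w‖) := by
        gcongr
        exact ContinuousLinearMap.le_opNorm _ _
    _ = _ := by ring

theorem opNorm_nonneg (A : Matrix ι ι ℂ) : 0 ≤ opNorm A := norm_nonneg _

/-- Perturbation of the energy of `v` by a vector `w` under a bounded operator. -/
theorem energy_add_vec_ge {A : Matrix ι ι ℂ} (hA : A.IsHermitian) (v w : ι → ℂ) :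
    energy A v - sqNorm v / 2 - (opNorm A + 2 * opNorm A ^ 2) * sqNorm w ≤ energy A (v + w) := by
  have e : energy A (v + w) = energy A v + 2 * (star v ⬝ᵥ A *ᵥ w).re + energy A w := by
    have hs : star w ⬝ᵥ A *ᵥ v = star (star v ⬝ᵥ A *ᵥ w) := by
      rw [star_dotProduct, star_mulVec, hA.eq, ← dotProduct_mulVec]
    simp only [energy, star_add, mulVec_add, add_dotProduct, dotProduct_add, Complex.add_re, hs]
    simp
    ring
  have h1 := (abs_le.mp ((Complex.abs_re_le_norm _).trans (norm_dotProduct_mulVec_le A v w))).1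
  have h2 := (abs_le.mp ((Complex.abs_re_le_norm _).trans (norm_dotProduct_mulVec_le A w w))).1
  -- The square in the hint is Young's inequality `2‖A‖‖v‖‖w‖ ≤ ‖v‖²/2 + 2‖A‖²‖w‖²` for the cross
  -- term.
  rw [e, sqNorm_eq_norm, sqNorm_eq_norm]
  unfold energy at *
  nlinarith [sq_nonneg (‖WithLp.toLp 2 v‖ - 2 * (opNorm A * ‖WithLp.toLp 2 w‖))]

/-- A variational lower bound for the spectral gap. -/
theorem le_spectralGap {A : Matrix ι ι ℂ} (hA : A.IsHermitian) (hι : 1 < Fintype.card ι)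
    {a b : ℝ} {η : ι → ℂ} (hη : 0 < sqNorm η) (ha : energy A η ≤ a * sqNorm η)
    (hb : ∀ v, star η ⬝ᵥ v = 0 → b * sqNorm v ≤ energy A v) :
    b - a ≤ spectralGap hA := by
  set e := hA.eigenvectorBasis
  set σ : Fin (Fintype.card ι) ≃ ι := Fintype.equivOfCardEq (Fintype.card_fin _)
  have hev : ∀ k, hA.eigenvalues (σ k) = hA.eigenvalues₀ k := fun k => by
    simp [IsHermitian.eigenvalues, σ]
  set k₀ : Fin (Fintype.card ι) := Fin.rev ⟨0, by omega⟩
  set k₁ : Fin (Fintype.card ι) := Fin.rev ⟨1, hι⟩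
  have hk : k₀ ≠ k₁ := by
    intro h
    have := Fin.rev_injective h
    simp at this
  have hgap : spectralGap hA = hA.eigenvalues₀ k₁ - hA.eigenvalues₀ k₀ := by
    simp [spectralGap, eigenvalueAt, hι, k₀, k₁, (by omega : 0 < Fintype.card ι)]
  have h01 : hA.eigenvalues₀ k₀ ≤ hA.eigenvalues₀ k₁ :=
    hA.eigenvalues₀_antitone (by simp only [k₀, k₁, Fin.le_def, Fin.val_rev]; omega)
  have hmin : ∀ i, hA.eigenvalues₀ k₀ ≤ hA.eigenvalues i := by
    intro i
    rw [← σ.apply_symm_apply i, hev]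
    refine hA.eigenvalues₀_antitone ?_
    simp only [k₀, Fin.le_def, Fin.val_rev]
    have := (σ.symm i).2
    omega
  have hAe : ∀ i, toEuclideanCLM (𝕜 := ℂ) A (e i) = (hA.eigenvalues i : ℂ) • e i := by
    intro i
    ext j
    have := congrFun (hA.mulVec_eigenvectorBasis i) j
    simpa [e] using this
  have hen : ∀ v, energy A v = ∑ i, hA.eigenvalues i * ‖inner ℂ (e i) (WithLp.toLp 2 v)‖ ^ 2 := by
    intro v
    have h : star v ⬝ᵥ A *ᵥ v =
        inner ℂ (WithLp.toLp 2 v) (toEuclideanCLM (𝕜 := ℂ) A (WithLp.toLp 2 v)) := by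
      rw [EuclideanSpace.inner_eq_star_dotProduct, dotProduct_comm]
      simp
    have hsymm : ∀ i, inner ℂ (e i) (toEuclideanCLM (𝕜 := ℂ) A (WithLp.toLp 2 v)) =
        hA.eigenvalues i * inner ℂ (e i) (WithLp.toLp 2 v) := by
      intro i
      have := (isSymmetric_toEuclideanLin_iff.mpr hA) (e i) (WithLp.toLp 2 v)
      have h2 : toEuclideanLin A (e i) = (hA.eigenvalues i : ℂ) • e i := hAe i
      rw [h2, inner_smul_left] at this
      simpa using this.symm
    rw [energy, h, ← e.sum_inner_mul_inner, Complex.re_sum]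
    refine Finset.sum_congr rfl fun i _ => ?_
    rw [hsymm, mul_left_comm, ← inner_conj_symm, ← Complex.normSq_eq_conj_mul_self,
      Complex.normSq_eq_norm_sq, ← Complex.ofReal_mul, Complex.ofReal_re]
  have hsq : ∀ v, sqNorm v = ∑ i, ‖inner ℂ (e i) (WithLp.toLp 2 v)‖ ^ 2 := by
    intro v
    rw [sqNorm_eq_norm, e.sum_sq_norm_inner_right]
  have hlow : hA.eigenvalues₀ k₀ ≤ a := by
    have : hA.eigenvalues₀ k₀ * sqNorm η ≤ energy A η := by
      rw [hsq, hen, Finset.mul_sum]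
      exact Finset.sum_le_sum fun i _ => mul_le_mul_of_nonneg_right (hmin i) (sq_nonneg _)
    exact le_of_mul_le_mul_right (this.trans ha) hη
  have hhigh : b ≤ hA.eigenvalues₀ k₁ := by
    -- The plane spanned by the two lowest eigenvectors meets the hyperplane orthogonal to `η`, and
    -- on that plane the energy is at most `λ₁` times the squared norm.
    obtain ⟨α, β, hαβ, hne⟩ : ∃ α β : ℂ,
        inner ℂ (WithLp.toLp 2 η) (α • e (σ k₀) + β • e (σ k₁)) = 0 ∧
          0 < ‖α‖ ^ 2 + ‖β‖ ^ 2 := by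
      by_cases h : inner ℂ (WithLp.toLp 2 η) (e (σ k₀)) = 0
      · exact ⟨1, 0, by simp [h], by simp⟩
      · refine ⟨inner ℂ (WithLp.toLp 2 η) (e (σ k₁)), -inner ℂ (WithLp.toLp 2 η) (e (σ k₀)),
          by simp [inner_smul_right]; ring, ?_⟩
        have : 0 < ‖-inner ℂ (WithLp.toLp 2 η) (e (σ k₀))‖ := by simpa using h
        positivity
    set v : ι → ℂ := WithLp.ofLp (α • e (σ k₀) + β • e (σ k₁))
    have hv : WithLp.toLp 2 v = α • e (σ k₀) + β • e (σ k₁) := rfl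
    have hσ : σ k₀ ≠ σ k₁ := fun h => hk (σ.injective h)
    have hc : ∀ i, inner ℂ (e i) (WithLp.toLp 2 v) =
        (if i = σ k₀ then α else 0) + (if i = σ k₁ then β else 0) := by
      intro i
      rw [hv, inner_add_right, inner_smul_right, inner_smul_right,
        orthonormal_iff_ite.mp e.orthonormal, orthonormal_iff_ite.mp e.orthonormal]
      simp
    have hc2 : ∀ i, ‖inner ℂ (e i) (WithLp.toLp 2 v)‖ ^ 2 =
        (if i = σ k₀ then ‖α‖ ^ 2 else 0) + (if i = σ k₁ then ‖β‖ ^ 2 else 0) := by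
      intro i
      rw [hc]
      by_cases h1 : i = σ k₀
      · simp [h1, hσ]
      · by_cases h2 : i = σ k₁ <;> simp [h1, h2, hσ.symm]
    have h0 : star η ⬝ᵥ v = 0 := by
      rw [← hαβ, ← hv, EuclideanSpace.inner_eq_star_dotProduct, dotProduct_comm]
    have h1 := hb v h0
    rw [hsq, hen] at h1
    simp only [hc2, mul_add, Finset.sum_add_distrib, mul_ite, mul_zero, Finset.sum_ite_eq',
      Finset.mem_univ, if_true, hev] at h1
    have h2 : b * (‖α‖ ^ 2 + ‖β‖ ^ 2) ≤ hA.eigenvalues₀ k₁ * (‖α‖ ^ 2 + ‖β‖ ^ 2) := by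
      nlinarith [sq_nonneg ‖α‖]
    exact le_of_mul_le_mul_right h2 hne
  rw [hgap]
  linarith

theorem spectralGap_nonneg {A : Matrix ι ι ℂ} (hA : A.IsHermitian) (hι : 1 < Fintype.card ι) :
    0 ≤ spectralGap hA := by
  have h : hA.eigenvalues₀ (Fin.rev ⟨0, by omega⟩) ≤ hA.eigenvalues₀ (Fin.rev ⟨1, hι⟩) :=
    hA.eigenvalues₀_antitone (by simp only [Fin.le_def, Fin.val_rev]; omega)
  simp [spectralGap, eigenvalueAt, hι, (by omega : 0 < Fintype.card ι)]
  exact h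

end LinearAlgebra

end TwoLocal

namespace TwoLocal

open Matrix

/-! ### The unary clock and operators compressed to legal states. -/

noncomputable section Clock

/-- The legal clock state `1^t 0^{N-t}` of time `t`. -/
def legal (N t : ℕ) : Fin N → Fin 2 := fun j => if j.val < t then 1 else 0

variable {N : ℕ}

theorem legal_eq_one_iff {t : ℕ} {q : Fin N} : legal N t q = 1 ↔ q.val < t := by
  simp [legal]

theorem legal_eq_zero_iff {t : ℕ} {q : Fin N} : legal N t q = 0 ↔ t ≤ q.val := by
  simp [legal]

theorem legal_apply_eq_iff {t t' : ℕ} {q : Fin N} :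
    legal N t q = legal N t' q ↔ (q.val < t ↔ q.val < t') := by
  unfold legal
  split_ifs with h1 h2 h2 <;> simp [h1, h2]

theorem legal_inj {t t' : ℕ} (ht : t ≤ N) (ht' : t' ≤ N) : legal N t = legal N t' ↔ t = t' := by
  refine ⟨fun h => ?_, fun h => h ▸ rfl⟩
  have h' : ∀ q, (hq : q < N) → (q < t ↔ q < t') := fun q hq =>
    legal_apply_eq_iff.mp (congrFun h ⟨q, hq⟩)
  rcases lt_trichotomy t t' with h1 | h1 | h1
  · have := h' t (by omega); omega
  · exact h1
  · have := h' t' (by omega); omega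

theorem onClock_ketbra_apply {j : ℕ} (h1 : 1 ≤ j) (h2 : j ≤ N) (a b : Fin 2)
    (c c' : Fin N → Fin 2) :
    onClock N (ketbra a b) j c c' =
      if (∀ q : Fin N, q.val ≠ j - 1 → c q = c' q) ∧
        c ⟨j - 1, by omega⟩ = a ∧ c' ⟨j - 1, by omega⟩ = b then 1 else 0 := by
  simp only [onClock, dif_pos (And.intro h1 h2), onQubit, ketbra, single_apply, ← ite_and]
  refine if_congr ?_ rfl rfl
  refine and_congr ?_ (and_congr eq_comm eq_comm)
  exact ⟨fun h q hq => h q (by rw [Ne, Fin.ext_iff]; exact hq),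
    fun h q hq => h q (by rw [Ne, Fin.ext_iff] at hq; exact hq)⟩

theorem clockPair_apply {i j : ℕ} (h1 : 1 ≤ i) (h2 : i < j) (h3 : j ≤ N) (a b a' b' : Fin 2)
    (c c' : Fin N → Fin 2) :
    clockPair N a b a' b' i j c c' =
      if (∀ q : Fin N, q.val ≠ i - 1 → q.val ≠ j - 1 → c q = c' q) ∧
        (c ⟨i - 1, by omega⟩ = a ∧ c' ⟨i - 1, by omega⟩ = a') ∧
        (c ⟨j - 1, by omega⟩ = b ∧ c' ⟨j - 1, by omega⟩ = b') then 1 else 0 := by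
  have hne : (⟨i - 1, by omega⟩ : Fin N) ≠ ⟨j - 1, by omega⟩ := by
    intro h; simp only [Fin.mk.injEq] at h; omega
  rw [clockPair, onClock, onClock, dif_pos ⟨h1, by omega⟩, dif_pos ⟨by omega, h3⟩,
    onQubit_mul_apply hne]
  simp only [ketbra, single_apply, ← ite_and, ite_zero_mul_ite_zero, one_mul]
  refine if_congr ?_ rfl rfl
  refine and_congr ?_ (and_congr (and_congr eq_comm eq_comm) (and_congr eq_comm eq_comm))
  refine forall_congr' fun q => ?_
  rw [Ne, Ne, Fin.ext_iff, Fin.ext_iff]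

/-- On legal clock states, the clock operator `B` is the matrix unit `|p⟩⟨q|`. -/
def IsLegalUnit (B : QubitOp N) (p q : ℕ) : Prop :=
  ∀ t ≤ N, ∀ t' ≤ N, B (legal N t) (legal N t') = if t = p ∧ t' = q then 1 else 0

/-- Two unary strings that differ in one bit only have consecutive lengths. If a length were not the
expected one, the strings would also disagree at the neighbouring bit that the proof inspects. -/
theorem isLegalUnit_raise {s : ℕ} (h1 : 1 ≤ s) (h2 : s ≤ N) :
    IsLegalUnit (onClock N (ketbra 1 0) s) s (s - 1) := by
  intro t ht t' ht'
  rw [onClock_ketbra_apply h1 h2]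
  simp only [legal_apply_eq_iff, legal_eq_one_iff, legal_eq_zero_iff]
  refine if_congr ⟨fun ⟨h, h3, h4⟩ => ?_, fun h => ⟨fun q hq => by omega, by omega, by omega⟩⟩
    rfl rfl
  constructor
  · by_contra hc
    have := h ⟨s, by omega⟩ (by simp; omega)
    simp at this; omega
  · by_contra hc
    have := h ⟨t', by omega⟩ (by simp; omega)
    simp at this; omega

theorem IsLegalUnit.conjTranspose {B : QubitOp N} {p q : ℕ} (hB : IsLegalUnit B p q) :
    IsLegalUnit B.conjTranspose q p := by
  intro t ht t' ht'
  rw [conjTranspose_apply, hB t' ht' t ht]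
  simp only [and_comm]
  split_ifs <;> simp

theorem isLegalUnit_lower {s : ℕ} (h1 : 1 ≤ s) (h2 : s ≤ N) :
    IsLegalUnit (onClock N (ketbra 0 1) s) (s - 1) s := by
  have := (isLegalUnit_raise h1 h2).conjTranspose
  rwa [onClock_conjTranspose, ketbra_conjTranspose] at this

theorem isLegalUnit_first (h : 1 ≤ N) : IsLegalUnit (onClock N (ketbra 0 0) 1) 0 0 := by
  intro t ht t' ht'
  rw [onClock_ketbra_apply le_rfl h]
  simp only [legal_apply_eq_iff, legal_eq_zero_iff]
  exact if_congr ⟨fun ⟨h, h3, h4⟩ => by omega,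
    fun h => ⟨fun q hq => by omega, by omega, by omega⟩⟩ rfl rfl

theorem isLegalUnit_last (h : 1 ≤ N) : IsLegalUnit (onClock N (ketbra 1 1) N) N N := by
  intro t ht t' ht'
  rw [onClock_ketbra_apply h le_rfl]
  simp only [legal_apply_eq_iff, legal_eq_one_iff]
  exact if_congr ⟨fun ⟨h, h3, h4⟩ => by omega,
    fun h => ⟨fun q hq => by omega, by omega, by omega⟩⟩ rfl rfl

theorem isLegalUnit_proj10 {s : ℕ} (h1 : 1 ≤ s) (h2 : s + 1 ≤ N) :
    IsLegalUnit (proj10 N s (s + 1)) s s := by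
  intro t ht t' ht'
  rw [proj10, clockPair_apply h1 (by omega) h2]
  simp only [legal_apply_eq_iff, legal_eq_one_iff, legal_eq_zero_iff]
  exact if_congr ⟨fun ⟨h, h3, h4⟩ => by omega,
    fun h => ⟨fun q hq hq' => by omega, by omega, by omega⟩⟩ rfl rfl

theorem isLegalUnit_double_raise {s : ℕ} (h1 : 1 ≤ s) (h2 : s + 1 ≤ N) :
    IsLegalUnit (clockPair N 1 1 0 0 s (s + 1)) (s + 1) (s - 1) := by
  intro t ht t' ht'
  rw [clockPair_apply h1 (by omega) h2]
  simp only [legal_apply_eq_iff, legal_eq_one_iff, legal_eq_zero_iff]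
  refine if_congr ⟨fun ⟨h, h3, h4⟩ => ?_,
    fun h => ⟨fun q hq hq' => by omega, by omega, by omega⟩⟩ rfl rfl
  constructor
  · by_contra hc
    have := h ⟨s + 1, by omega⟩ (by simp; omega) (by simp)
    simp at this; omega
  · by_contra hc
    have := h ⟨t', by omega⟩ (by simp; omega) (by simp; omega)
    simp at this; omega

theorem isLegalUnit_double_lower {s : ℕ} (h1 : 1 ≤ s) (h2 : s + 1 ≤ N) :
    IsLegalUnit (clockPair N 0 0 1 1 s (s + 1)) (s - 1) (s + 1) := by
  have := (isLegalUnit_double_raise h1 h2).conjTranspose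
  rwa [clockPair_conjTranspose _ _ _ _ _ (by omega)] at this

/-- A clock string without a violated clock constraint `01` is legal. -/
theorem exists_eq_legal {c : Fin N → Fin 2}
    (h : ∀ q, (hq : q + 1 < N) → ¬ (c ⟨q, by omega⟩ = 0 ∧ c ⟨q + 1, hq⟩ = 1)) :
    ∃ t ≤ N, c = legal N t := by
  classical
  by_cases hall : ∀ q, c q = 1
  · exact ⟨N, le_rfl, funext fun q => by rw [hall, eq_comm, legal_eq_one_iff]; exact q.2⟩
  · have hex : ∃ t, ∃ ht : t < N, c ⟨t, ht⟩ = 0 := by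
      push Not at hall
      obtain ⟨q, hq⟩ := hall
      exact ⟨q, q.2, by change c q = 0; omega⟩
    obtain ⟨ht, h0⟩ := Nat.find_spec hex
    -- The clock time is the position of the first `0`; the absence of `01` keeps all later bits at
    -- `0`.
    set t := Nat.find hex
    have hge : ∀ k, (hk : t + k < N) → c ⟨t + k, hk⟩ = 0 := by
      intro k
      induction k with
      | zero => intro _; exact h0
      | succ k ih =>
        intro hk
        have h1 := ih (by omega)
        have h2 := h (t + k) hk
        simp only [h1, true_and] at h2
        have : t + (k + 1) = t + k + 1 := rfl
        simp only [this]
        omega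
    refine ⟨t, ht.le, funext fun q => ?_⟩
    by_cases hq : q.val < t
    · have := Nat.find_min hex hq
      push Not at this
      rw [legal_eq_one_iff.mpr hq]
      exact Fin.eq_one_of_ne_zero _ (this q.2)
    · rw [legal_eq_zero_iff.mpr (by omega)]
      have := hge (q.val - t) (by have := q.2; omega)
      simpa [Nat.add_sub_of_le (not_lt.mp hq)] using this

section Embed

variable {κ : Type*}

/-- The joint state `∑ₜ φ_t ⊗ |t⟩`. -/
def embed (N : ℕ) (φ : ℕ → κ → ℂ) : κ × (Fin N → Fin 2) → ℂ :=
  fun p => ∑ t ∈ Finset.range (N + 1), if p.2 = legal N t then φ t p.1 else 0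

theorem embed_legal (φ : ℕ → κ → ℂ) {t : ℕ} (ht : t ≤ N) (z : κ) :
    embed N φ (z, legal N t) = φ t z := by
  rw [embed, Finset.sum_eq_single t]
  · simp
  · intro s hs hst
    rw [if_neg]
    rw [legal_inj ht (by simpa [Nat.lt_succ_iff] using hs)]
    exact fun h => hst h.symm
  · intro h; exact absurd (Finset.mem_range.mpr (by omega)) h

/-- The legal part of a joint state. -/
def legalPart (ψ : κ × (Fin N → Fin 2) → ℂ) : ℕ → κ → ℂ := fun t z => ψ (z, legal N t)

theorem embed_legalPart_apply (ψ : κ × (Fin N → Fin 2) → ℂ) (p : κ × (Fin N → Fin 2)) :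
    (embed N (legalPart ψ) p = ψ p ∧ ∃ t ≤ N, p.2 = legal N t) ∨
      (embed N (legalPart ψ) p = 0 ∧ ¬ ∃ t ≤ N, p.2 = legal N t) := by
  by_cases h : ∃ t ≤ N, p.2 = legal N t
  · left
    refine ⟨?_, h⟩
    obtain ⟨t, ht, hp⟩ := h
    obtain ⟨z, c⟩ := p
    subst hp
    rw [embed_legal _ ht]
    rfl
  · right
    refine ⟨Finset.sum_eq_zero fun t ht => if_neg fun h' => h ⟨t, ?_, h'⟩, h⟩
    simpa [Nat.lt_succ_iff] using ht

variable [Fintype κ]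

theorem star_embed_dotProduct (φ : ℕ → κ → ℂ) (ψ : κ × (Fin N → Fin 2) → ℂ) :
    star (embed N φ) ⬝ᵥ ψ =
      ∑ t ∈ Finset.range (N + 1), star (φ t) ⬝ᵥ fun z => ψ (z, legal N t) := by
  simp only [dotProduct, Pi.star_apply, embed, star_sum, Finset.sum_mul]
  rw [Finset.sum_comm]
  refine Finset.sum_congr rfl fun t _ => ?_
  rw [Fintype.sum_prod_type]
  refine Finset.sum_congr rfl fun z _ => ?_
  simp [apply_ite, ite_mul]

theorem kronecker_mulVec_embed (A : Matrix κ κ ℂ) (B : QubitOp N) (φ : ℕ → κ → ℂ) (z : κ)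
    (c : Fin N → Fin 2) :
    ((A ⊗ₖ B) *ᵥ embed N φ) (z, c) =
      ∑ t ∈ Finset.range (N + 1), B c (legal N t) * (A *ᵥ φ t) z := by
  simp only [mulVec, dotProduct, embed, Finset.mul_sum]
  rw [Finset.sum_comm]
  refine Finset.sum_congr rfl fun t _ => ?_
  rw [Fintype.sum_prod_type]
  refine Finset.sum_congr rfl fun z' _ => ?_
  simp only [kroneckerMap_apply, mul_ite, mul_zero, Finset.sum_ite_eq', Finset.mem_univ, if_true]
  ring

/-- Clock operators may lead out of the legal space, but the energy of a legal state sees only their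
compression to it. -/
theorem IsLegalUnit.energy_embed {B : QubitOp N} {p q : ℕ} (hB : IsLegalUnit B p q) (hp : p ≤ N)
    (hq : q ≤ N) (A : Matrix κ κ ℂ) (φ : ℕ → κ → ℂ) :
    energy (A ⊗ₖ B) (embed N φ) = (star (φ p) ⬝ᵥ A *ᵥ φ q).re := by
  have h : ∀ t ∈ Finset.range (N + 1), (fun z => ((A ⊗ₖ B) *ᵥ embed N φ) (z, legal N t)) =
      if t = p then A *ᵥ φ q else 0 := by
    intro t ht
    have ht : t ≤ N := by simpa [Nat.lt_succ_iff] using ht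
    funext z
    rw [kronecker_mulVec_embed, Finset.sum_eq_single q]
    · rw [hB t ht q hq]
      by_cases h : t = p <;> simp [h]
    · intro s hs hsq
      rw [hB t ht s (by simpa [Nat.lt_succ_iff] using hs)]
      simp [hsq]
    · intro h; exact absurd (Finset.mem_range.mpr (by omega)) h
  rw [energy, star_embed_dotProduct]
  congr 1
  rw [Finset.sum_congr rfl fun t ht => by rw [h t ht], Finset.sum_eq_single p]
  · simp
  · intro t _ ht; simp [ht]
  · intro h; exact absurd (Finset.mem_range.mpr (by omega)) h

theorem sqNorm_embed (φ : ℕ → κ → ℂ) :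
    sqNorm (embed N φ) = ∑ t ∈ Finset.range (N + 1), sqNorm (φ t) := by
  have h := star_embed_dotProduct φ (embed N φ)
  rw [dotProduct_star_self] at h
  have h2 : ∀ t ∈ Finset.range (N + 1), (star (φ t) ⬝ᵥ fun z => embed N φ (z, legal N t)) =
      (sqNorm (φ t) : ℂ) := by
    intro t ht
    rw [← dotProduct_star_self]
    congr 1
    funext z
    exact embed_legal φ (by simpa [Nat.lt_succ_iff] using ht) z
  rw [Finset.sum_congr rfl h2] at h
  exact_mod_cast h

theorem sqNorm_eq_legal_add (ψ : κ × (Fin N → Fin 2) → ℂ) :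
    sqNorm ψ = sqNorm (embed N (legalPart ψ)) + sqNorm (ψ - embed N (legalPart ψ)) := by
  simp only [sqNorm, ← Finset.sum_add_distrib]
  refine Finset.sum_congr rfl fun p _ => ?_
  rcases embed_legalPart_apply ψ p with h | h <;> simp [h.1]

end Embed

end Clock

end TwoLocal

namespace TwoLocal

open Matrix

/-! ### One-qubit gates, `Z` and `CZ` as matrices. -/

noncomputable section Gates

variable {m : ℕ}

theorem onQubit_mul_onQubit (i : Fin m) (G H : Matrix (Fin 2) (Fin 2) ℂ) :
    onQubit i G * onQubit i H = onQubit i (G * H) := by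
  ext a b
  rw [mul_apply]
  have h := Fintype.sum_of_injective (fun x : Fin 2 => Function.update a i x)
    (fun x y hxy => by simpa using congrFun hxy i)
    (fun x => if ∀ j, j ≠ i → a j = b j then G (a i) x * H x (b i) else 0)
    (fun c => onQubit i G a c * onQubit i H c b) ?_ ?_
  · rw [← h, onQubit]
    split_ifs <;> simp [mul_apply]
  · intro c hc
    have : ¬ ∀ j, j ≠ i → a j = c j := by
      intro h
      refine hc ⟨c i, funext fun j => ?_⟩
      by_cases hj : j = i
      · subst hj; simp
      · simp [hj, h j hj]
    simp [onQubit, this]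
  · intro x
    have h1 : ∀ j, j ≠ i → a j = Function.update a i x j := fun j hj => by simp [hj]
    have h2 : (∀ j, j ≠ i → Function.update a i x j = b j) ↔ ∀ j, j ≠ i → a j = b j :=
      forall_congr' fun j => forall_congr' fun hj => by simp [hj]
    simp only [onQubit, if_pos h1, h2]
    split_ifs <;> simp

theorem onQubit_diagonal (i : Fin m) (d : Fin 2 → ℂ) :
    onQubit i (diagonal d) = diagonal fun z => d (z i) := by
  ext a b
  by_cases h : a = b
  · subst h; simp [onQubit]
  · rw [diagonal_apply_ne _ h, onQubit]
    split_ifs with h1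
    · rw [diagonal_apply_ne]
      intro h2
      exact h (funext fun j => by
        by_cases hj : j = i
        · subst hj; exact h2
        · exact h1 j hj)
    · rfl

theorem onQubit_unitary (i : Fin m) (G : unitaryGroup (Fin 2) ℂ) :
    (onQubit i (G : Matrix (Fin 2) (Fin 2) ℂ)).conjTranspose * onQubit i G = 1 := by
  rw [onQubit_conjTranspose, onQubit_mul_onQubit]
  have h : (G : Matrix (Fin 2) (Fin 2) ℂ).conjTranspose * G = 1 := UnitaryGroup.star_mul_self G
  rw [h, ← diagonal_one, onQubit_diagonal, diagonal_one]

/-- The eigenvalue of `Z` on the basis state `b`. -/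
def zSign (b : Fin 2) : ℝ := if b = 0 then 1 else -1

theorem zSign_sq (b : Fin 2) : zSign b ^ 2 = 1 := by
  unfold zSign; split_ifs <;> norm_num

theorem pauliZ_eq_diagonal : pauliZ = diagonal fun b => (zSign b : ℂ) := by
  ext a b
  fin_cases a <;> fin_cases b <;> simp [pauliZ, ketbra, zSign]

theorem ketbra_self_eq_diagonal (a : Fin 2) :
    ketbra a a = diagonal fun b => if b = a then (1 : ℂ) else 0 := by
  ext b c
  fin_cases a <;> fin_cases b <;> fin_cases c <;> simp [ketbra]

/-- The eigenvalue of `CZ` on a basis state with bits `a, b`. -/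
def czSign (a b : Fin 2) : ℝ := if a = 1 ∧ b = 1 then -1 else 1

theorem czSign_sq (a b : Fin 2) : czSign a b ^ 2 = 1 := by
  unfold czSign; split_ifs <;> norm_num

/-- The gate `CZ` on the qubits `f, s`. -/
def czGate (f s : Fin m) : QubitOp m := diagonal fun z => (czSign (z f) (z s) : ℂ)

theorem czGate_unitary (f s : Fin m) : (czGate f s).conjTranspose * czGate f s = 1 := by
  rw [czGate, diagonal_conjTranspose, diagonal_mul_diagonal, ← diagonal_one]
  congr 1
  funext z
  have := czSign_sq (z f) (z s)
  simp only [Pi.star_apply, RCLike.star_def, Complex.conj_ofReal]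
  rw [← Complex.ofReal_mul, ← sq, this, Complex.ofReal_one]

end Gates

/-! ### The quadratic form of a `CZ` gate conjugated by `Z` gates. -/

noncomputable section Forms

variable {κ : Type*} [Fintype κ]

/-- The real part of the inner product. -/
def reInner (v w : κ → ℂ) : ℝ := (star v ⬝ᵥ w).re

theorem reInner_eq_sum (v w : κ → ℂ) :
    reInner v w = ∑ z, ((v z).re * (w z).re + (v z).im * (w z).im) := by
  simp [reInner, dotProduct, Complex.re_sum]

theorem reInner_comm (v w : κ → ℂ) : reInner v w = reInner w v := by
  simp only [reInner_eq_sum, mul_comm]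

theorem reInner_self (v : κ → ℂ) : reInner v v = sqNorm v := by
  rw [reInner, dotProduct_star_self, Complex.ofReal_re]

theorem norm_sq_eq_re_im (z : ℂ) : ‖z‖ ^ 2 = z.re ^ 2 + z.im ^ 2 := by
  rw [Complex.sq_norm, Complex.normSq_apply]; ring

theorem sqNorm_sub (v w : κ → ℂ) :
    sqNorm (v - w) = sqNorm v + sqNorm w - 2 * reInner v w := by
  simp only [sqNorm, reInner_eq_sum, ← Finset.sum_add_distrib, Finset.mul_sum,
    ← Finset.sum_sub_distrib]
  refine Finset.sum_congr rfl fun z _ => ?_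
  simp only [norm_sq_eq_re_im, Pi.sub_apply, Complex.sub_re, Complex.sub_im]
  ring

theorem reInner_mulVec_left (V : Matrix κ κ ℂ) (v w : κ → ℂ) :
    reInner (V.conjTranspose *ᵥ v) w = reInner v (V *ᵥ w) := by
  rw [reInner, reInner, star_mulVec, conjTranspose_conjTranspose, dotProduct_mulVec]

variable [DecidableEq κ]

theorem sqNorm_mulVec_of_unitary {V : Matrix κ κ ℂ} (hV : V.conjTranspose * V = 1) (w : κ → ℂ) :
    sqNorm (V *ᵥ w) = sqNorm w := by
  have h := dotProduct_star_self (V *ᵥ w)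
  rw [star_mulVec, ← dotProduct_mulVec, mulVec_mulVec, hV, one_mulVec, dotProduct_star_self] at h
  exact_mod_cast h.symm

theorem sqNorm_sub_mulVec {V : Matrix κ κ ℂ} (hV : V.conjTranspose * V = 1) (v w : κ → ℂ) :
    sqNorm (v - V *ᵥ w) =
      sqNorm v + sqNorm w - reInner v (V *ᵥ w) - reInner w (V.conjTranspose *ᵥ v) := by
  rw [sqNorm_sub, sqNorm_mulVec_of_unitary hV, reInner_comm w, reInner_mulVec_left]
  ring

/-- A diagonal sign matrix is an isometry and its own inverse. This lets the `Z` steps before a `CZ`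
be read backwards in time, so that both halves of `H_time` are treated alike. -/
theorem sqNorm_sub_sign_comm {σ : κ → ℝ} (hσ : ∀ z, σ z ^ 2 = 1) (v w : κ → ℂ) :
    sqNorm (v - diagonal (fun z => (σ z : ℂ)) *ᵥ w) =
      sqNorm (w - diagonal (fun z => (σ z : ℂ)) *ᵥ v) := by
  refine Finset.sum_congr rfl fun z _ => ?_
  simp only [Pi.sub_apply, mulVec_diagonal]
  have h : v z - σ z * w z = -σ z * (w z - σ z * v z) := by
    have : (σ z : ℂ) ^ 2 = 1 := by exact_mod_cast hσ z
    linear_combination (-v z) * this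
  have h1 : |σ z| = 1 := by
    rcases sq_eq_one_iff.mp (hσ z) with h | h <;> simp [h]
  rw [h, norm_mul, norm_neg, Complex.norm_real, Real.norm_eq_abs, h1, one_mul]

/-- The form of one half of `H_time` on the states at three consecutive times. -/
def halfForm (d e f : κ → ℂ) : ℝ :=
  sqNorm d + 6 * sqNorm e + sqNorm f + 4 * reInner f d + 2 * reInner e d + 2 * reInner f e

/-- With `u` and `w` the deviations from the two sign steps, the form equals its value on an exact
history, plus cross terms in `d * u` and `d * w`, plus a nonnegative form in `u` and `w`. Only the
cross terms can do harm. -/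
theorem real_halfForm_ge {σ₁ σ₂ : ℝ} (h₁ : σ₁ ^ 2 = 1) (h₂ : σ₂ ^ 2 = 1) {Λ : ℝ} (hΛ : 0 < Λ)
    (d e f : ℝ) :
    (8 + 4 * (σ₁ * σ₂) + 2 * σ₁ + 2 * σ₂) * d ^ 2 - 8 / Λ * d ^ 2
        - 40 * Λ * ((e - σ₁ * d) ^ 2 + (f - σ₂ * e) ^ 2) ≤
      d ^ 2 + 6 * e ^ 2 + f ^ 2 + 4 * (f * d) + 2 * (e * d) + 2 * (f * e) := by
  obtain ⟨u, rfl⟩ : ∃ u, e = σ₁ * d + u := ⟨e - σ₁ * d, by ring⟩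
  obtain ⟨w, rfl⟩ : ∃ w, f = σ₂ * (σ₁ * d + u) + w := ⟨f - σ₂ * (σ₁ * d + u), by ring⟩
  -- The coefficients of `d * u` and `d * w` are at most `24` and `8` in absolute value, so this
  -- splitting stays within the budgets `8 / Λ` and `40 * Λ`.
  have young : ∀ x : ℝ, |d * x| ≤ d ^ 2 / Λ / 6 + 3 / 2 * (Λ * x ^ 2) := by
    intro x
    have h' : 0 ≤ (|d| - 3 * Λ * |x|) ^ 2 / Λ := by positivity
    have e : (|d| - 3 * Λ * |x|) ^ 2 / Λ = d ^ 2 / Λ - 6 * (|d| * |x|) + 9 * (Λ * x ^ 2) := by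
      rw [← sq_abs d, ← sq_abs x]
      field_simp
      ring
    rw [abs_mul]
    linarith
  have hu := abs_le.mp (young u)
  have hw := abs_le.mp (young w)
  have hd : 0 ≤ d ^ 2 / Λ := by positivity
  have hu2 : 0 ≤ Λ * u ^ 2 := by positivity
  have hw2 : 0 ≤ Λ * w ^ 2 := by positivity
  -- This is the form at `d = 0`, written as a sum of squares.
  have hq : 0 ≤ 5 * u ^ 2 + (u + (σ₂ * u + w)) ^ 2 := by positivity
  have e8 : 8 / Λ * d ^ 2 = 8 * (d ^ 2 / Λ) := by ring
  rw [e8]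
  clear young e8 hΛ
  generalize d ^ 2 / Λ = K at *
  rcases sq_eq_one_iff.mp h₁ with rfl | rfl <;> rcases sq_eq_one_iff.mp h₂ with rfl | rfl <;>
    linarith [hq, hu.1, hu.2, hw.1, hw.2]

end Forms

end TwoLocal

namespace TwoLocal

open Matrix

noncomputable section Forms

variable {κ : Type*} [Fintype κ]

theorem halfForm_eq_sum (d e f : κ → ℂ) :
    halfForm d e f = ∑ z,
      (((d z).re ^ 2 + 6 * (e z).re ^ 2 + (f z).re ^ 2 + 4 * ((f z).re * (d z).re)
          + 2 * ((e z).re * (d z).re) + 2 * ((f z).re * (e z).re))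
        + ((d z).im ^ 2 + 6 * (e z).im ^ 2 + (f z).im ^ 2 + 4 * ((f z).im * (d z).im)
          + 2 * ((e z).im * (d z).im) + 2 * ((f z).im * (e z).im))) := by
  simp only [halfForm, sqNorm, reInner_eq_sum, Finset.mul_sum, ← Finset.sum_add_distrib]
  refine Finset.sum_congr rfl fun z _ => ?_
  simp only [norm_sq_eq_re_im]
  ring

theorem halfForm_eq {σ₁ σ₂ : κ → ℝ} (h₁ : ∀ z, σ₁ z ^ 2 = 1) (h₂ : ∀ z, σ₂ z ^ 2 = 1)
    {d e f : κ → ℂ} (he : ∀ z, e z = σ₁ z * d z) (hf : ∀ z, f z = σ₂ z * e z) :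
    halfForm d e f = ∑ z, (8 + 4 * (σ₁ z * σ₂ z) + 2 * σ₁ z + 2 * σ₂ z) * ‖d z‖ ^ 2 := by
  rw [halfForm_eq_sum]
  refine Finset.sum_congr rfl fun z _ => ?_
  have h1 := h₁ z
  have h2 := h₂ z
  rw [hf, he]
  simp only [norm_sq_eq_re_im, Complex.re_ofReal_mul, Complex.im_ofReal_mul]
  rcases sq_eq_one_iff.mp h1 with h | h <;> rcases sq_eq_one_iff.mp h2 with h' | h' <;>
    rw [h, h'] <;> ring

variable [DecidableEq κ]

theorem halfForm_ge {σ₁ σ₂ : κ → ℝ} (h₁ : ∀ z, σ₁ z ^ 2 = 1) (h₂ : ∀ z, σ₂ z ^ 2 = 1) {Λ : ℝ}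
    (hΛ : 0 < Λ) (d e f : κ → ℂ) :
    ∑ z, (8 + 4 * (σ₁ z * σ₂ z) + 2 * σ₁ z + 2 * σ₂ z) * ‖d z‖ ^ 2 - 8 / Λ * sqNorm d
        - 40 * Λ * (sqNorm (e - diagonal (fun z => (σ₁ z : ℂ)) *ᵥ d)
          + sqNorm (f - diagonal (fun z => (σ₂ z : ℂ)) *ᵥ e)) ≤ halfForm d e f := by
  rw [halfForm_eq_sum]
  simp only [sqNorm, ← Finset.sum_add_distrib, Finset.mul_sum, ← Finset.sum_sub_distrib]
  refine Finset.sum_le_sum fun z _ => ?_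
  have hre := real_halfForm_ge (h₁ z) (h₂ z) hΛ (d z).re (e z).re (f z).re
  have him := real_halfForm_ge (h₁ z) (h₂ z) hΛ (d z).im (e z).im (f z).im
  simp only [norm_sq_eq_re_im, Pi.sub_apply, mulVec_diagonal, Complex.sub_re, Complex.sub_im,
    Complex.re_ofReal_mul, Complex.im_ofReal_mul]
  linarith

/-- The diagonal weight of `H_time` on the history of a basis state with bits `p, q`. -/
def timeWeight (p q : Fin 2) : ℝ :=
  8 + 4 * (zSign p * zSign q) + 2 * zSign p + 2 * zSign q

/-- The eigenvalue of the operator of the computation qubits in `H_qubit`. -/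
def qubitWeight (p q : Fin 2) : ℝ :=
  (-2) * (if p = 0 then 1 else 0) + (-2) * (if q = 0 then 1 else 0)
    + (if p = 1 then 1 else 0) + (if q = 1 then 1 else 0)

/-- The right side is `2(d - c)²` for bits `00`, `(d - c)²/2` for `01` and `10`, and `(d + c)²` for
`11`; the sign change in the last case is the sign of `CZ`. -/
theorem weights_ge (p q : Fin 2) (d c : ℝ) :
    (d - czSign p q * c) ^ 2 / 2 ≤
      timeWeight p q / 8 * (d ^ 2 + c ^ 2) + qubitWeight p q * (d * c) := by
  fin_cases p <;> fin_cases q <;> simp [timeWeight, qubitWeight, zSign, czSign] <;>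
    nlinarith [sq_nonneg (d - c), sq_nonneg (d + c)]

theorem weights_eq (p q : Fin 2) (c : ℝ) :
    timeWeight p q / 8 * ((czSign p q * c) ^ 2 + c ^ 2)
      + qubitWeight p q * ((czSign p q * c) * c) = 0 := by
  fin_cases p <;> fin_cases q <;> simp [timeWeight, qubitWeight, zSign, czSign] <;> ring

variable {m : ℕ}

/-- The energy of `H_qubit + H_time` on a legal history with states `a, b, c` just before and
`d, e, g` just after the `CZ` gate on the qubits `f, s`. -/
def czForm (f s : Fin m) (d e g c b a : (Fin m → Fin 2) → ℂ) : ℝ :=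
  ∑ z, qubitWeight (z f) (z s) * ((d z).re * (c z).re + (d z).im * (c z).im)
    + (halfForm d e g + halfForm c b a) / 8

/-- The gate `Z` on qubit `i`. -/
def zGate (i : Fin m) : QubitOp m := diagonal fun z => (zSign (z i) : ℂ)

theorem timeWeight_eq {f s i j : Fin m} (h : (i = f ∧ j = s) ∨ (i = s ∧ j = f)) (z : Fin m → Fin 2) :
    8 + 4 * (zSign (z i) * zSign (z j)) + 2 * zSign (z i) + 2 * zSign (z j) =
      timeWeight (z f) (z s) := by
  rcases h with ⟨rfl, rfl⟩ | ⟨rfl, rfl⟩ <;> unfold timeWeight <;> ring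

/-- The indefinite form is bounded below by the `CZ` defect, up to an error that trades the four `Z`
defects against a small multiple of the norm. The order of the two `Z` gates is immaterial because
`timeWeight` is symmetric in the bits. -/
theorem czForm_ge {f s i j k l : Fin m} (h : (i = f ∧ j = s) ∨ (i = s ∧ j = f))
    (h' : (k = f ∧ l = s) ∨ (k = s ∧ l = f)) {Λ : ℝ} (hΛ : 0 < Λ)
    (d e g c b a : (Fin m → Fin 2) → ℂ) :
    sqNorm (d - czGate f s *ᵥ c) / 2 - 1 / Λ * (sqNorm d + sqNorm c)
        - 5 * Λ * (sqNorm (e - zGate i *ᵥ d) + sqNorm (g - zGate j *ᵥ e)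
          + sqNorm (c - zGate l *ᵥ b) + sqNorm (b - zGate k *ᵥ a)) ≤
      czForm f s d e g c b a := by
  have h1 := halfForm_ge (σ₁ := fun z => zSign (z i)) (σ₂ := fun z => zSign (z j))
    (fun z => zSign_sq (z i)) (fun z => zSign_sq (z j)) hΛ d e g
  have h2 := halfForm_ge (σ₁ := fun z => zSign (z l)) (σ₂ := fun z => zSign (z k))
    (fun z => zSign_sq (z l)) (fun z => zSign_sq (z k)) hΛ c b a
  simp only [timeWeight_eq h] at h1
  simp only [timeWeight_eq (h'.symm.imp And.symm And.symm)] at h2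
  have e1 := sqNorm_sub_sign_comm (σ := fun z => zSign (z l)) (fun z => zSign_sq (z l)) c b
  have e2 := sqNorm_sub_sign_comm (σ := fun z => zSign (z k)) (fun z => zSign_sq (z k)) b a
  have h3 : sqNorm (d - czGate f s *ᵥ c) / 2 ≤
      ∑ z, qubitWeight (z f) (z s) * ((d z).re * (c z).re + (d z).im * (c z).im)
        + (∑ z, timeWeight (z f) (z s) * ‖d z‖ ^ 2 + ∑ z, timeWeight (z f) (z s) * ‖c z‖ ^ 2) / 8 := by
    simp only [sqNorm, Finset.sum_div, ← Finset.sum_add_distrib]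
    refine Finset.sum_le_sum fun z _ => ?_
    have hre := weights_ge (z f) (z s) (d z).re (c z).re
    have him := weights_ge (z f) (z s) (d z).im (c z).im
    simp only [norm_sq_eq_re_im, Pi.sub_apply, czGate, mulVec_diagonal, Complex.sub_re,
      Complex.sub_im, Complex.re_ofReal_mul, Complex.im_ofReal_mul]
    linarith
  unfold zGate czForm
  rw [e1, e2]
  have : 8 / Λ = 8 * (1 / Λ) := by ring
  rw [this] at h1 h2
  linarith

theorem czForm_eq_zero {f s i j k l : Fin m} (h : (i = f ∧ j = s) ∨ (i = s ∧ j = f))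
    (h' : (k = f ∧ l = s) ∨ (k = s ∧ l = f)) {d e g c b a : (Fin m → Fin 2) → ℂ}
    (hd : d = czGate f s *ᵥ c) (he : e = zGate i *ᵥ d) (hg : g = zGate j *ᵥ e)
    (hc : c = zGate l *ᵥ b) (hb : b = zGate k *ᵥ a) :
    czForm f s d e g c b a = 0 := by
  have zg : ∀ {i : Fin m} {v w : (Fin m → Fin 2) → ℂ}, v = zGate i *ᵥ w →
      ∀ z, v z = zSign (z i) * w z := by
    rintro i v w rfl z
    rw [zGate, mulVec_diagonal]
  have inv : ∀ {i : Fin m} {v w : (Fin m → Fin 2) → ℂ}, v = zGate i *ᵥ w →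
      ∀ z, w z = zSign (z i) * v z := by
    intro i v w hv z
    have : (zSign (z i) : ℂ) ^ 2 = 1 := by exact_mod_cast zSign_sq (z i)
    rw [zg hv]
    linear_combination (-w z) * this
  have h1 := halfForm_eq (κ := Fin m → Fin 2) (σ₁ := fun z => zSign (z i)) (σ₂ := fun z => zSign (z j))
    (fun z => zSign_sq (z i)) (fun z => zSign_sq (z j)) (zg he) (zg hg)
  have h2 := halfForm_eq (κ := Fin m → Fin 2) (σ₁ := fun z => zSign (z l)) (σ₂ := fun z => zSign (z k))
    (fun z => zSign_sq (z l)) (fun z => zSign_sq (z k))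
    (inv hc) (inv hb)
  simp only [timeWeight_eq h] at h1
  simp only [timeWeight_eq (h'.symm.imp And.symm And.symm)] at h2
  rw [czForm, h1, h2]
  simp only [Finset.sum_div, ← Finset.sum_add_distrib]
  refine Finset.sum_eq_zero fun z _ => ?_
  have hre := weights_eq (z f) (z s) (c z).re
  have him := weights_eq (z f) (z s) (c z).im
  subst hd
  simp only [norm_sq_eq_re_im, czGate, mulVec_diagonal, Complex.re_ofReal_mul,
    Complex.im_ofReal_mul]
  linarith

end Forms

/-! ### Poincaré inequalities on a path. -/

section Poincare

/-- Telescoping followed by the Cauchy–Schwarz inequality. -/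
theorem norm_sub_sq_le_card_mul (x : ℕ → ℂ) {N t t' : ℕ} (ht : t ≤ N) (ht' : t' ≤ N) :
    ‖x t - x t'‖ ^ 2 ≤ N * ∑ s ∈ Finset.range N, ‖x (s + 1) - x s‖ ^ 2 := by
  wlog h : t' ≤ t generalizing t t'
  · rw [norm_sub_rev]; exact this ht' ht (by omega)
  have h1 : ‖x t - x t'‖ ≤ ∑ s ∈ Finset.range N, ‖x (s + 1) - x s‖ := by
    rw [← Finset.sum_Ico_sub x h]
    refine (norm_sum_le _ _).trans (Finset.sum_le_sum_of_subset_of_nonneg ?_ ?_)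
    · intro s hs
      simp only [Finset.mem_Ico, Finset.mem_range] at hs ⊢
      omega
    · exact fun _ _ _ => norm_nonneg _
  calc _ ≤ (∑ s ∈ Finset.range N, ‖x (s + 1) - x s‖) ^ 2 := by gcongr
    _ ≤ _ := by
      have := sq_sum_le_card_mul_sum_sq (s := Finset.range N) (f := fun s => ‖x (s + 1) - x s‖)
      simpa using this

theorem sum_norm_sq_le_of_start (x : ℕ → ℂ) (N : ℕ) :
    ∑ t ∈ Finset.range (N + 1), ‖x t‖ ^ 2 ≤
      2 * (N + 1) * ‖x 0‖ ^ 2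
        + 2 * N * (N + 1) * ∑ s ∈ Finset.range N, ‖x (s + 1) - x s‖ ^ 2 := by
  have h : ∀ t ∈ Finset.range (N + 1), ‖x t‖ ^ 2 ≤
      2 * ‖x 0‖ ^ 2 + 2 * (N * ∑ s ∈ Finset.range N, ‖x (s + 1) - x s‖ ^ 2) := by
    intro t ht
    have h1 := norm_sub_sq_le_card_mul x (t := t) (t' := 0) (N := N)
      (by simpa [Nat.lt_succ_iff] using ht) (by omega)
    have h2 : ‖x t‖ ≤ ‖x t - x 0‖ + ‖x 0‖ := by simpa using norm_add_le (x t - x 0) (x 0)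
    nlinarith [sq_nonneg (‖x t - x 0‖ - ‖x 0‖), norm_nonneg (x t)]
  refine (Finset.sum_le_sum h).trans (le_of_eq ?_)
  simp
  ring

theorem sum_norm_sq_le_of_mean_zero (x : ℕ → ℂ) (N : ℕ)
    (h0 : ∑ t ∈ Finset.range (N + 1), x t = 0) :
    ∑ t ∈ Finset.range (N + 1), ‖x t‖ ^ 2 ≤
      N * (N + 1) * ∑ s ∈ Finset.range N, ‖x (s + 1) - x s‖ ^ 2 := by
  set E := ∑ s ∈ Finset.range N, ‖x (s + 1) - x s‖ ^ 2
  have h : ∀ t ∈ Finset.range (N + 1), ‖x t‖ ^ 2 ≤ N * E := by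
    intro t ht
    have ht' : t ≤ N := by simpa [Nat.lt_succ_iff] using ht
    -- Mean zero exhibits `x t` as the average of its differences to all vertices.
    have e : ((N : ℂ) + 1) * x t = ∑ s ∈ Finset.range (N + 1), (x t - x s) := by
      rw [Finset.sum_sub_distrib, h0]; simp
    have h1 : ((N : ℝ) + 1) * ‖x t‖ ≤ ∑ s ∈ Finset.range (N + 1), ‖x t - x s‖ := by
      have := norm_sum_le (Finset.range (N + 1)) fun s => x t - x s
      rw [← e, norm_mul] at this
      have e2 : ‖(N : ℂ) + 1‖ = (N : ℝ) + 1 := by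
        rw [← Nat.cast_succ, Complex.norm_natCast]; simp
      rwa [e2] at this
    have h2 : (((N : ℝ) + 1) * ‖x t‖) ^ 2 ≤ (N + 1) * ((N + 1) * (N * E)) := by
      calc _ ≤ (∑ s ∈ Finset.range (N + 1), ‖x t - x s‖) ^ 2 := by gcongr
        _ ≤ (N + 1) * ∑ s ∈ Finset.range (N + 1), ‖x t - x s‖ ^ 2 := by
          have := sq_sum_le_card_mul_sum_sq (s := Finset.range (N + 1)) (f := fun s => ‖x t - x s‖)
          simpa using this
        _ ≤ (N + 1) * ∑ s ∈ Finset.range (N + 1), (N * E) := by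
          gcongr with s hs
          exact norm_sub_sq_le_card_mul x ht' (by simpa [Nat.lt_succ_iff] using hs)
        _ = _ := by simp
    have hN : (0 : ℝ) < ((N : ℝ) + 1) ^ 2 := by positivity
    refine le_of_mul_le_mul_left ?_ hN
    linarith
  refine (Finset.sum_le_sum h).trans (le_of_eq ?_)
  simp
  ring

/-- Energy gap of a path of length `N` with a penalty, at its first vertex, on all coordinates
but one. -/
theorem path_gap {κ : Type*} [Fintype κ] [DecidableEq κ] (χ : ℕ → κ → ℂ) (N : ℕ) (y : κ)
    {J K Δ : ℝ} (hΔ : 0 ≤ Δ) (hJ : (2 * N + 2) * Δ ≤ J) (hK : 2 * N * (N + 1) * Δ ≤ K)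
    (h0 : ∑ t ∈ Finset.range (N + 1), χ t y = 0) :
    Δ * ∑ t ∈ Finset.range (N + 1), sqNorm (χ t) ≤
      J * ∑ z, (if z = y then 0 else ‖χ 0 z‖ ^ 2)
        + K * ∑ s ∈ Finset.range N, sqNorm (χ (s + 1) - χ s) := by
  simp only [sqNorm]
  rw [Finset.sum_comm, Finset.sum_comm (s := Finset.range N), Finset.mul_sum, Finset.mul_sum,
    Finset.mul_sum, ← Finset.sum_add_distrib]
  refine Finset.sum_le_sum fun z _ => ?_
  simp only [Pi.sub_apply]
  set E := ∑ s ∈ Finset.range N, ‖χ (s + 1) z - χ s z‖ ^ 2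
  have hE : 0 ≤ E := Finset.sum_nonneg fun _ _ => sq_nonneg _
  have hKE := mul_le_mul_of_nonneg_right hK hE
  split_ifs with hz
  · have h := mul_le_mul_of_nonneg_left (sum_norm_sq_le_of_mean_zero (fun t => χ t y) N h0) hΔ
    subst hz
    have : 0 ≤ (N : ℝ) * (N + 1) * Δ * E := by positivity
    simp only [mul_zero, zero_add]
    linarith
  · have h := mul_le_mul_of_nonneg_left (sum_norm_sq_le_of_start (fun t => χ t z) N) hΔ
    have hJE := mul_le_mul_of_nonneg_right hJ (sq_nonneg ‖χ 0 z‖)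
    linarith

end Poincare

end TwoLocal

/-! ### Propagation terms evaluated on legal states. -/

namespace TwoLocal

open Matrix

noncomputable section Clock

theorem energy_sub {ι : Type*} [Fintype ι] (A B : Matrix ι ι ℂ) (v : ι → ℂ) :
    energy (A - B) v = energy A v - energy B v := by
  simp [energy, sub_mulVec, dotProduct_sub]

theorem IsLegalUnit.energy_one_embed {κ : Type*} [Fintype κ] [DecidableEq κ] {N : ℕ}
    {B : QubitOp N} {p q : ℕ} (hB : IsLegalUnit B p q) (hp : p ≤ N) (hq : q ≤ N) (φ : ℕ → κ → ℂ) :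
    energy ((1 : Matrix κ κ ℂ) ⊗ₖ B) (embed N φ) = reInner (φ p) (φ q) := by
  rw [hB.energy_embed hp hq, one_mulVec, reInner]

theorem onClock_ketbra_self (N : ℕ) (a : Fin 2) {j : ℕ} (h : 1 ≤ j ∧ j ≤ N) :
    onClock N (ketbra a a) j =
      diagonal fun c => if c ⟨j - 1, by omega⟩ = a then (1 : ℂ) else 0 := by
  rw [onClock, dif_pos h, ketbra_self_eq_diagonal, onQubit_diagonal]

end Clock

namespace Circuit

noncomputable section

variable {m : ℕ} (U : Circuit m) (M : ℕ)

/-- The gate of the pre-idled circuit at time `t`. -/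
def stepGate (t : ℕ) : QubitOp m :=
  if t ∈ U.singleTimes M then U.idledGate M t
  else czGate (U.fst ((t - M) / U.L)) (U.snd ((t - M) / U.L))

theorem idledGate_unitary (t : ℕ) :
    (U.idledGate M t).conjTranspose * U.idledGate M t = 1 := by
  unfold idledGate
  split_ifs
  · simp
  · exact onQubit_unitary _ _

theorem stepGate_unitary (t : ℕ) : (U.stepGate M t).conjTranspose * U.stepGate M t = 1 := by
  unfold stepGate
  split_ifs
  · exact U.idledGate_unitary M t
  · exact czGate_unitary _ _

/-- The squared deviation of `φ` from a correct computation at step `t`. -/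
def defect (φ : ℕ → (Fin m → Fin 2) → ℂ) (t : ℕ) : ℝ :=
  sqNorm (φ t - U.stepGate M t *ᵥ φ (t - 1))

theorem defect_nonneg (φ : ℕ → (Fin m → Fin 2) → ℂ) (t : ℕ) : 0 ≤ U.defect M φ t :=
  sqNorm_nonneg _

theorem mem_singleTimes {t : ℕ} :
    t ∈ U.singleTimes M ↔ (1 ≤ t ∧ t ≤ U.T + M) ∧ ∀ l ∈ Finset.Icc 1 U.T₂, l * U.L + M ≠ t := by
  simp [singleTimes]

/-- On legal states the term is the expanded square of `φ t - V_t φ (t - 1)`; the special projectors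
at the two ends still single out the times `t` and `t - 1`. -/
theorem energy_HpropAt {t : ℕ} (ht : t ∈ U.singleTimes M) (φ : ℕ → (Fin m → Fin 2) → ℂ) :
    energy (U.HpropAt M t) (embed (U.T + M) φ) = U.defect M φ t / 2 := by
  obtain ⟨⟨h1, h2⟩, -⟩ := (U.mem_singleTimes M).mp ht
  have u1 : IsLegalUnit (if t = U.T + M then onClock (U.T + M) (ketbra 1 1) t
      else proj10 (U.T + M) t (t + 1)) t t := by
    split_ifs with h
    · rw [h]; exact isLegalUnit_last (by omega)
    · exact isLegalUnit_proj10 h1 (by omega)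
  have u2 : IsLegalUnit (if t = 1 then onClock (U.T + M) (ketbra 0 0) t
      else proj10 (U.T + M) (t - 1) t) (t - 1) (t - 1) := by
    split_ifs with h
    · rw [h]; exact isLegalUnit_first (by omega)
    · have := isLegalUnit_proj10 (N := U.T + M) (s := t - 1) (by omega) (by omega)
      rwa [Nat.sub_add_cancel h1] at this
  rw [HpropAt, energy_smul, energy_sub, energy_sub, energy_add,
    u1.energy_one_embed h2 h2, u2.energy_one_embed (by omega) (by omega),
    (isLegalUnit_raise h1 h2).energy_embed h2 (by omega),
    (isLegalUnit_lower h1 h2).energy_embed (by omega) h2, defect, stepGate, if_pos ht,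
    sqNorm_sub_mulVec (U.idledGate_unitary M t), reInner_self, reInner_self, reInner, reInner]
  ring

theorem energy_Hprop1 (φ : ℕ → (Fin m → Fin 2) → ℂ) :
    energy (U.Hprop1 M) (embed (U.T + M) φ) = (∑ t ∈ U.singleTimes M, U.defect M φ t) / 2 := by
  rw [Hprop1, energy_sum, Finset.sum_div]
  exact Finset.sum_congr rfl fun t ht => U.energy_HpropAt M ht φ

theorem L_le_mul {l : ℕ} (hl : l ∈ Finset.Icc 1 U.T₂) : U.L ≤ l * U.L :=
  Nat.le_mul_of_pos_left _ (Finset.mem_Icc.mp hl).1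

theorem mul_L_le {l : ℕ} (hl : l ∈ Finset.Icc 1 U.T₂) : l * U.L + 3 ≤ U.T := by
  obtain ⟨h1, h2⟩ := Finset.mem_Icc.mp hl
  have := Nat.mul_le_mul_right U.L h2
  have := U.le_T (by omega)
  omega

theorem qubitWeight_operator (f s : Fin m) :
    ((-2 : ℝ) • onQubit f (ketbra 0 0) + (-2 : ℝ) • onQubit s (ketbra 0 0)
        + onQubit f (ketbra 1 1) + onQubit s (ketbra 1 1) : QubitOp m) =
      diagonal fun z => (qubitWeight (z f) (z s) : ℂ) := by
  simp only [ketbra_self_eq_diagonal, onQubit_diagonal]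
  ext a b
  by_cases h : a = b
  · subst h
    simp only [Matrix.add_apply, Matrix.smul_apply, diagonal_apply_eq, qubitWeight,
      Complex.real_smul, Complex.ofReal_add, Complex.ofReal_mul, apply_ite Complex.ofReal,
      Complex.ofReal_one, Complex.ofReal_zero]
  · simp [h]

theorem re_star_dotProduct_diagonal {κ : Type*} [Fintype κ] [DecidableEq κ] (d : κ → ℝ)
    (v w : κ → ℂ) :
    (star v ⬝ᵥ diagonal (fun z => (d z : ℂ)) *ᵥ w).re =
      ∑ z, d z * ((v z).re * (w z).re + (v z).im * (w z).im) := by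
  simp only [dotProduct, mulVec_diagonal, Complex.re_sum, Pi.star_apply]
  refine Finset.sum_congr rfl fun z _ => ?_
  simp
  ring

theorem energy_cz {l : ℕ} (hl : l ∈ Finset.Icc 1 U.T₂) (φ : ℕ → (Fin m → Fin 2) → ℂ) {t : ℕ}
    (hlt : l * U.L + M = t) (hM : 0 < M) :
    energy (U.Hqubit M l + U.Htime M l) (embed (U.T + M) φ) =
      czForm (U.fst l) (U.snd l) (φ t) (φ (t + 1)) (φ (t + 2)) (φ (t - 1)) (φ (t - 2))
        (φ (t - 3)) := by
  have h3 := U.three_le_L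
  have hL := U.L_le_mul hl
  have hT := U.mul_L_le hl
  have hN : t + 3 ≤ U.T + M := by omega
  -- Hence clock qubit `t - 3` exists and none of the subtractions below is truncated.
  have h4 : 4 ≤ t := by omega
  have pr : ∀ i j, j = i + 1 → 1 ≤ i → j ≤ U.T + M →
      energy ((1 : QubitOp m) ⊗ₖ proj10 (U.T + M) i j) (embed (U.T + M) φ) = sqNorm (φ i) := by
    rintro i j rfl h1 h2
    rw [(isLegalUnit_proj10 h1 h2).energy_one_embed (by omega) (by omega), reInner_self]
  have fl : ∀ i j, i = j + 1 → i ≤ U.T + M →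
      energy ((1 : QubitOp m) ⊗ₖ clockFlip (U.T + M) i) (embed (U.T + M) φ) =
        2 * reInner (φ i) (φ j) := by
    rintro i j rfl h2
    rw [clockFlip, kronecker_add, energy_add,
      (isLegalUnit_raise (by omega) h2).energy_one_embed h2 (by omega),
      (isLegalUnit_lower (by omega) h2).energy_one_embed (by omega) h2,
      reInner_comm (φ (j + 1 - 1)), Nat.add_sub_cancel]
    ring
  have df : ∀ i j k, i = k + 1 → j = i + 1 → j ≤ U.T + M →
      energy ((1 : QubitOp m) ⊗ₖ clockDoubleFlip (U.T + M) i j) (embed (U.T + M) φ) =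
        2 * reInner (φ j) (φ k) := by
    rintro i j k rfl rfl h2
    rw [clockDoubleFlip, kronecker_add, energy_add,
      (isLegalUnit_double_raise (by omega) h2).energy_one_embed h2 (by omega),
      (isLegalUnit_double_lower (by omega) h2).energy_one_embed (by omega) h2,
      reInner_comm (φ (k + 1 - 1)), Nat.add_sub_cancel]
    ring
  have hq : energy (U.Hqubit M l) (embed (U.T + M) φ) =
      ∑ z, qubitWeight (z (U.fst l)) (z (U.snd l)) *
        ((φ t z).re * (φ (t - 1) z).re + (φ t z).im * (φ (t - 1) z).im) := by
    simp only [Hqubit, hlt]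
    rw [energy_smul, qubitWeight_operator, kronecker_add, energy_add,
      (isLegalUnit_raise (by omega) (by omega)).energy_embed (by omega) (by omega),
      (isLegalUnit_lower (by omega) (by omega)).energy_embed (by omega) (by omega),
      re_star_dotProduct_diagonal, re_star_dotProduct_diagonal, ← Finset.sum_add_distrib,
      Finset.mul_sum]
    exact Finset.sum_congr rfl fun z _ => by ring
  have ht : energy (U.Htime M l) (embed (U.T + M) φ) =
      (halfForm (φ t) (φ (t + 1)) (φ (t + 2)) + halfForm (φ (t - 1)) (φ (t - 2)) (φ (t - 3)))
        / 8 := by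
    simp only [Htime, hlt, kronecker_add, kronecker_smul, energy_add, energy_smul]
    rw [pr t _ rfl (by omega) (by omega), pr (t + 1) _ rfl (by omega) (by omega),
      pr (t + 2) _ rfl (by omega) (by omega), pr (t - 3) _ (by omega) (by omega) (by omega),
      pr (t - 2) _ (by omega) (by omega) (by omega), pr (t - 1) _ (by omega) (by omega) (by omega),
      fl (t + 1) t rfl (by omega), fl (t + 2) (t + 1) rfl (by omega),
      fl (t - 2) (t - 3) (by omega) (by omega), fl (t - 1) (t - 2) (by omega) (by omega),
      df (t + 1) (t + 2) t rfl rfl (by omega),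
      df (t - 2) (t - 1) (t - 3) (by omega) (by omega) (by omega),
      halfForm, halfForm, reInner_comm (φ (t - 1)) (φ (t - 3)),
      reInner_comm (φ (t - 1)) (φ (t - 2)), reInner_comm (φ (t - 2)) (φ (t - 3))]
    ring
  rw [energy_add, hq, ht, czForm]

/-- The quotient in `stepGate` recovers the index `l` from the time of the gate. -/
theorem stepGate_cz {l : ℕ} (hl : l ∈ Finset.Icc 1 U.T₂) :
    U.stepGate M (l * U.L + M) = czGate (U.fst l) (U.snd l) := by
  have h : l * U.L + M ∉ U.singleTimes M := by
    rw [mem_singleTimes]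
    exact fun h => h.2 l hl rfl
  have h3 := U.three_le_L
  rw [stepGate, if_neg h, Nat.add_sub_cancel, Nat.mul_div_cancel _ (by omega)]

/-- Distinct `CZ` times are at least `L ≥ 3` apart, so no time at distance one or two from a `CZ`
gate belongs to another one. -/
theorem mem_singleTimes_of_near {l k : ℕ} (hl : l ∈ Finset.Icc 1 U.T₂)
    (hk : k + 1 = l * U.L ∨ k + 2 = l * U.L ∨ k = l * U.L + 1 ∨ k = l * U.L + 2) :
    k + M ∈ U.singleTimes M := by
  have h3 := U.three_le_L
  have hL := U.L_le_mul hl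
  have hT := U.mul_L_le hl
  rw [mem_singleTimes]
  refine ⟨⟨by omega, by omega⟩, fun l' _ h => ?_⟩
  rcases lt_trichotomy l l' with h1 | h1 | h1
  · have := Nat.mul_le_mul_right U.L (Nat.succ_le_of_lt h1)
    rw [Nat.succ_mul] at this
    omega
  · subst h1; omega
  · have := Nat.mul_le_mul_right U.L (Nat.succ_le_of_lt h1)
    rw [Nat.succ_mul] at this
    omega

theorem stepGate_z {l k : ℕ} (hl : l ∈ Finset.Icc 1 U.T₂)
    (hk : k + 1 = l * U.L ∨ k + 2 = l * U.L ∨ k = l * U.L + 1 ∨ k = l * U.L + 2) :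
    U.stepGate M (k + M) = zGate (U.qubit k) := by
  have h3 := U.three_le_L
  have hL := U.L_le_mul hl
  have hG : (U.gate k : Matrix (Fin 2) (Fin 2) ℂ) = pauliZ := by
    obtain ⟨b1, b2⟩ := U.gate_before l hl
    obtain ⟨a1, a2⟩ := U.gate_after l hl
    rcases hk with h | h | h | h
    · rwa [show l * U.L - 1 = k by omega] at b2
    · rwa [show l * U.L - 2 = k by omega] at b1
    · rwa [← h] at a1
    · rwa [← h] at a2
  rw [stepGate, if_pos (U.mem_singleTimes_of_near M hl hk), idledGate, if_neg (by omega),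
    Nat.add_sub_cancel, hG, pauliZ_eq_diagonal, onQubit_diagonal, zGate]

end

end Circuit

end TwoLocal

/-! ### The history state and energy bounds for the individual terms. -/

namespace TwoLocal

open Matrix

namespace Circuit

noncomputable section

variable {m : ℕ} (U : Circuit m) (M : ℕ)

/-- The circuit up to time `t`. -/
def prefixGate : ℕ → QubitOp m
  | 0 => 1
  | t + 1 => U.stepGate M (t + 1) * prefixGate t

theorem prefixGate_unitary (t : ℕ) : (U.prefixGate M t).conjTranspose * U.prefixGate M t = 1 := by
  induction t with
  | zero => simp [prefixGate]
  | succ t ih =>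
    rw [prefixGate, conjTranspose_mul, Matrix.mul_assoc, ← Matrix.mul_assoc _ (U.stepGate M (t + 1)),
      stepGate_unitary, Matrix.one_mul, ih]

theorem prefixGate_unitary' (t : ℕ) : U.prefixGate M t * (U.prefixGate M t).conjTranspose = 1 :=
  mul_eq_one_comm.mp (U.prefixGate_unitary M t)

/-- The states `φ` in the frame co-moving with the computation. -/
def pullBack (φ : ℕ → (Fin m → Fin 2) → ℂ) (t : ℕ) : (Fin m → Fin 2) → ℂ :=
  (U.prefixGate M t).conjTranspose *ᵥ φ t

theorem sqNorm_pullBack (φ : ℕ → (Fin m → Fin 2) → ℂ) (t : ℕ) :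
    sqNorm (U.pullBack M φ t) = sqNorm (φ t) :=
  sqNorm_mulVec_of_unitary (by rw [conjTranspose_conjTranspose, prefixGate_unitary']) _

/-- In the co-moving frame correct propagation means being constant in time, so defects become plain
increments. -/
theorem sqNorm_pullBack_sub (φ : ℕ → (Fin m → Fin 2) → ℂ) (t : ℕ) :
    sqNorm (U.pullBack M φ (t + 1) - U.pullBack M φ t) = U.defect M φ (t + 1) := by
  rw [← sqNorm_mulVec_of_unitary (U.prefixGate_unitary M (t + 1)), mulVec_sub, pullBack, pullBack,
    mulVec_mulVec, prefixGate_unitary', one_mulVec, prefixGate, ← mulVec_mulVec, mulVec_mulVec (φ t),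
    prefixGate_unitary', one_mulVec, defect, Nat.add_sub_cancel]

/-- The history of the computation started in the basis state `y`. -/
def history (y : Fin m → Fin 2) (t : ℕ) : (Fin m → Fin 2) → ℂ :=
  U.prefixGate M t *ᵥ Pi.single y 1

theorem sqNorm_single {κ : Type*} [Fintype κ] [DecidableEq κ] (y : κ) :
    sqNorm (Pi.single y 1 : κ → ℂ) = 1 := by
  rw [sqNorm, Finset.sum_eq_single y] <;> simp +contextual

theorem sqNorm_history (y : Fin m → Fin 2) (t : ℕ) : sqNorm (U.history M y t) = 1 := by
  rw [history, sqNorm_mulVec_of_unitary (U.prefixGate_unitary M t), sqNorm_single]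

theorem history_zero (y : Fin m → Fin 2) : U.history M y 0 = Pi.single y 1 := by
  rw [history, prefixGate, one_mulVec]

theorem history_step (y : Fin m → Fin 2) {t : ℕ} (ht : 1 ≤ t) :
    U.history M y t = U.stepGate M t *ᵥ U.history M y (t - 1) := by
  obtain ⟨s, rfl⟩ : ∃ s, t = s + 1 := ⟨t - 1, by omega⟩
  rw [history, prefixGate, ← mulVec_mulVec, Nat.add_sub_cancel, history]

/-- Summed over `t`, this turns orthogonality to the history into the mean-zero condition of
`path_gap`. -/
theorem star_history_dotProduct (y : Fin m → Fin 2) (φ : ℕ → (Fin m → Fin 2) → ℂ) (t : ℕ) :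
    star (U.history M y t) ⬝ᵥ φ t = U.pullBack M φ t y := by
  rw [history, star_mulVec, ← dotProduct_mulVec, pullBack]
  simp

theorem defect_history (y : Fin m → Fin 2) {t : ℕ} (ht : 1 ≤ t) :
    U.defect M (U.history M y) t = 0 := by
  rw [defect, ← U.history_step M y ht, sub_self]
  simp [sqNorm]

/-! The energies of the terms of the Hamiltonian. -/

theorem energy_cz_ge {l : ℕ} (hl : l ∈ Finset.Icc 1 U.T₂) (hM : 0 < M)
    (φ : ℕ → (Fin m → Fin 2) → ℂ) {Λ : ℝ} (hΛ : 0 < Λ) :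
    U.defect M φ (l * U.L + M) / 2 - 1 / Λ * sqNorm (embed (U.T + M) φ)
        - 20 * Λ * ∑ t ∈ U.singleTimes M, U.defect M φ t ≤
      energy (U.Hqubit M l + U.Htime M l) (embed (U.T + M) φ) := by
  have h3 := U.three_le_L
  have hL := U.L_le_mul hl
  have hT := U.mul_L_le hl
  obtain ⟨k, hk⟩ : ∃ k, l * U.L = k + 2 := ⟨l * U.L - 2, by omega⟩
  have hz1 := U.stepGate_z M hl (k := k + 1) (by omega)
  have hz2 := U.stepGate_z M hl (k := k) (by omega)
  have hz3 := U.stepGate_z M hl (k := k + 3) (by omega)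
  have hz4 := U.stepGate_z M hl (k := k + 4) (by omega)
  have hm1 := U.mem_singleTimes_of_near M hl (k := k + 1) (by omega)
  have hm2 := U.mem_singleTimes_of_near M hl (k := k) (by omega)
  have hm3 := U.mem_singleTimes_of_near M hl (k := k + 3) (by omega)
  have hm4 := U.mem_singleTimes_of_near M hl (k := k + 4) (by omega)
  have hcz := U.stepGate_cz M hl
  have q1 := U.qubit_before l hl
  have q2 := U.qubit_after l hl
  rw [hk] at hcz q1 q2
  have e1 : k + 2 - 2 = k := rfl
  have e2 : k + 2 - 1 = k + 1 := rfl
  rw [e1, e2] at q1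
  -- Bounding each of the four `Z` defects by the full sum is wasteful, but it avoids accounting for
  -- `Z` steps shared by neighbouring `CZ` gates when `L` is `3` or `4`.
  have hle : ∀ t ∈ U.singleTimes M, U.defect M φ t ≤ ∑ t ∈ U.singleTimes M, U.defect M φ t :=
    fun t ht => Finset.single_le_sum (fun t _ => U.defect_nonneg M φ t) ht
  have d1 := hle _ hm1
  have d2 := hle _ hm2
  have d3 := hle _ hm3
  have d4 := hle _ hm4
  have hn : sqNorm (φ (k + 2 + M)) + sqNorm (φ (k + 2 + M - 1)) ≤
      sqNorm (embed (U.T + M) φ) := by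
    rw [sqNorm_embed]
    have : ({k + 2 + M, k + 2 + M - 1} : Finset ℕ) ⊆ Finset.range (U.T + M + 1) := by
      intro x hx
      simp only [Finset.mem_insert, Finset.mem_singleton] at hx
      rw [Finset.mem_range]
      omega
    have h := Finset.sum_le_sum_of_subset_of_nonneg (f := fun t => sqNorm (φ t)) this
      (fun _ _ _ => sqNorm_nonneg _)
    rwa [Finset.sum_pair (by omega)] at h
  rw [hk, U.energy_cz M hl φ (t := k + 2 + M) (by rw [hk]) hM]
  have key := czForm_ge q2 q1 hΛ (φ (k + 2 + M)) (φ (k + 2 + M + 1)) (φ (k + 2 + M + 2))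
    (φ (k + 2 + M - 1)) (φ (k + 2 + M - 2)) (φ (k + 2 + M - 3))
  have f0 : sqNorm (φ (k + 2 + M) - czGate (U.fst l) (U.snd l) *ᵥ φ (k + 2 + M - 1)) =
      U.defect M φ (k + 2 + M) := by rw [defect, hcz]
  have f1 : sqNorm (φ (k + 2 + M + 1) - zGate (U.qubit (k + 2 + 1)) *ᵥ φ (k + 2 + M)) =
      U.defect M φ (k + 3 + M) := by
    rw [defect, hz3, show k + 3 + M - 1 = k + 2 + M by omega,
      show k + 2 + M + 1 = k + 3 + M by omega]
  have f2 : sqNorm (φ (k + 2 + M + 2) - zGate (U.qubit (k + 2 + 2)) *ᵥ φ (k + 2 + M + 1)) =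
      U.defect M φ (k + 4 + M) := by
    rw [defect, hz4, show k + 4 + M - 1 = k + 2 + M + 1 by omega,
      show k + 2 + M + 2 = k + 4 + M by omega]
  have f3 : sqNorm (φ (k + 2 + M - 1) - zGate (U.qubit (k + 1)) *ᵥ φ (k + 2 + M - 2)) =
      U.defect M φ (k + 1 + M) := by
    rw [defect, hz1, show k + 1 + M - 1 = k + 2 + M - 2 by omega,
      show k + 2 + M - 1 = k + 1 + M by omega]
  have f4 : sqNorm (φ (k + 2 + M - 2) - zGate (U.qubit k) *ᵥ φ (k + 2 + M - 3)) =
      U.defect M φ (k + M) := by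
    rw [defect, hz2, show k + M - 1 = k + 2 + M - 3 by omega,
      show k + 2 + M - 2 = k + M by omega]
  rw [f0, f1, f2, f3, f4] at key
  have g1 := mul_le_mul_of_nonneg_left hn (one_div_nonneg.mpr hΛ.le)
  have g2 : 5 * Λ * (U.defect M φ (k + 3 + M) + U.defect M φ (k + 4 + M)
      + U.defect M φ (k + 1 + M) + U.defect M φ (k + M)) ≤
      5 * Λ * (4 * ∑ t ∈ U.singleTimes M, U.defect M φ t) :=
    mul_le_mul_of_nonneg_left (by linarith) (by positivity)
  linarith

theorem energy_Hprop2 (φ : ℕ → (Fin m → Fin 2) → ℂ) :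
    energy (U.Hprop2 M) (embed (U.T + M) φ) = ∑ l ∈ Finset.Icc 1 U.T₂,
      energy (U.Hqubit M l + U.Htime M l) (embed (U.T + M) φ) := by
  rw [Hprop2, energy_sum]

/-- When all `Z` and `CZ` steps are exact, the completed squares vanish (`czForm_eq_zero`). -/
theorem energy_Hprop2_history (hM : 0 < M) (y : Fin m → Fin 2) :
    energy (U.Hprop2 M) (embed (U.T + M) (U.history M y)) = 0 := by
  rw [energy_Hprop2]
  refine Finset.sum_eq_zero fun l hl => ?_
  have h3 := U.three_le_L
  have hL := U.L_le_mul hl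
  obtain ⟨k, hk⟩ : ∃ k, l * U.L = k + 2 := ⟨l * U.L - 2, by omega⟩
  have q1 := U.qubit_before l hl
  have q2 := U.qubit_after l hl
  have hcz := U.stepGate_cz M hl
  have st : ∀ t s, s + 1 = t →
      U.history M y t = U.stepGate M t *ᵥ U.history M y s := by
    rintro t s rfl
    exact U.history_step M y (by omega)
  have hz : ∀ j t s, t = j + M → s + 1 = t →
      (j + 1 = l * U.L ∨ j + 2 = l * U.L ∨ j = l * U.L + 1 ∨ j = l * U.L + 2) →
      U.history M y t = zGate (U.qubit j) *ᵥ U.history M y s := by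
    rintro j t s rfl h1 h2
    rw [st _ _ h1, U.stepGate_z M hl h2]
  rw [U.energy_cz M hl _ (t := l * U.L + M) rfl hM]
  refine czForm_eq_zero q2 q1 ?_ (hz _ _ _ (by omega) (by omega) (by omega))
    (hz _ _ _ (by omega) (by omega) (by omega)) (hz _ _ _ (by omega) (by omega) (by omega))
    (hz _ _ _ (by omega) (by omega) (by omega))
  rw [← hcz]
  exact st _ _ (by omega)

/-- The energy of `H_prop2` on a legal state at a single time. -/
theorem energy_Hprop2_ge_of_localized (hM : 0 < M) {s : ℕ} {φ : ℕ → (Fin m → Fin 2) → ℂ}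
    (hφ : ∀ t, t ≠ s → φ t = 0) :
    (∑ l ∈ Finset.Icc 1 U.T₂, sqNorm (φ (l * U.L + M))) / 8 ≤
      energy (U.Hprop2 M) (embed (U.T + M) φ) := by
  rw [energy_Hprop2, Finset.sum_div]
  refine Finset.sum_le_sum fun l hl => ?_
  have h3 := U.three_le_L
  have hL := U.L_le_mul hl
  rw [U.energy_cz M hl _ (t := l * U.L + M) rfl hM]
  generalize l * U.L = k at *
  have h0 : ∀ p q, p ≠ q → φ p = 0 ∨ φ q = 0 := by
    intro p q hpq
    by_cases hp : p = s
    · exact Or.inr (hφ q fun h => hpq (hp.trans h.symm))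
    · exact Or.inl (hφ p hp)
  -- All terms that couple different times vanish, which leaves the nonnegative diagonal projectors
  -- of `H_time`.
  have hr : ∀ p q, p ≠ q → reInner (φ p) (φ q) = 0 := by
    intro p q hpq
    rcases h0 p q hpq with h | h <;> simp [h, reInner_eq_sum]
  have h1 : ∀ z, (φ (k + M) z).re * (φ (k + M - 1) z).re
      + (φ (k + M) z).im * (φ (k + M - 1) z).im = 0 := by
    intro z
    rcases h0 (k + M) (k + M - 1) (by omega) with h | h <;> simp [h]
  have n1 := sqNorm_nonneg (φ (k + M + 1))
  have n2 := sqNorm_nonneg (φ (k + M + 2))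
  have n3 := sqNorm_nonneg (φ (k + M - 1))
  have n4 := sqNorm_nonneg (φ (k + M - 2))
  have n5 := sqNorm_nonneg (φ (k + M - 3))
  simp only [czForm, h1, halfForm, hr (k + M + 2) (k + M) (by omega),
    hr (k + M + 1) (k + M) (by omega), hr (k + M + 2) (k + M + 1) (by omega),
    hr (k + M - 3) (k + M - 1) (by omega), hr (k + M - 2) (k + M - 1) (by omega),
    hr (k + M - 3) (k + M - 2) (by omega), mul_zero, Finset.sum_const_zero]
  linarith

/-- The energy of `H_in` on a legal history, in terms of its first state. -/
theorem energy_Hin (hN : 0 < U.T + M) (y : Fin m → Fin 2) (φ : ℕ → (Fin m → Fin 2) → ℂ) :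
    energy (U.Hin M y) (embed (U.T + M) φ) =
      ∑ z, (∑ i, if z i = 1 - y i then (1 : ℝ) else 0) * ‖φ 0 z‖ ^ 2 := by
  rw [Hin, energy_sum]
  simp only [Finset.sum_mul]
  rw [Finset.sum_comm]
  refine Finset.sum_congr rfl fun i _ => ?_
  rw [(isLegalUnit_first hN).energy_embed (by omega) (by omega), ketbra_self_eq_diagonal,
    onQubit_diagonal]
  have := energy_diagonal (fun z : Fin m → Fin 2 => if z i = 1 - y i then (1 : ℝ) else 0) (φ 0)
  simpa only [energy, apply_ite Complex.ofReal, Complex.ofReal_one, Complex.ofReal_zero] using this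

theorem mismatch_ge (y z : Fin m → Fin 2) :
    (if z = y then (0 : ℝ) else 1) ≤ ∑ i, if z i = 1 - y i then (1 : ℝ) else 0 := by
  split_ifs with h
  · exact Finset.sum_nonneg fun i _ => by split_ifs <;> norm_num
  · obtain ⟨i, hi⟩ := Function.ne_iff.mp h
    have h1 : z i = 1 - y i := by
      generalize z i = a at *
      generalize y i = b at *
      revert a b; decide
    calc (1 : ℝ) = if z i = 1 - y i then (1 : ℝ) else 0 := by rw [if_pos h1]
      _ ≤ _ := Finset.single_le_sum (f := fun i => if z i = 1 - y i then (1 : ℝ) else 0)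
        (fun i _ => by split_ifs <;> norm_num) (Finset.mem_univ i)

theorem energy_Hin_ge (hN : 0 < U.T + M) (y : Fin m → Fin 2) (φ : ℕ → (Fin m → Fin 2) → ℂ) :
    ∑ z, (if z = y then 0 else ‖φ 0 z‖ ^ 2) ≤ energy (U.Hin M y) (embed (U.T + M) φ) := by
  rw [U.energy_Hin M hN]
  refine Finset.sum_le_sum fun z _ => ?_
  have := mul_le_mul_of_nonneg_right (mismatch_ge y z) (sq_nonneg ‖φ 0 z‖)
  rwa [ite_mul, zero_mul, one_mul] at this

theorem energy_Hin_nonneg (hN : 0 < U.T + M) (y : Fin m → Fin 2)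
    (φ : ℕ → (Fin m → Fin 2) → ℂ) : 0 ≤ energy (U.Hin M y) (embed (U.T + M) φ) :=
  (Finset.sum_nonneg fun z _ => by split_ifs <;> positivity).trans (U.energy_Hin_ge M hN y φ)

theorem energy_Hin_history (hN : 0 < U.T + M) (y : Fin m → Fin 2) :
    energy (U.Hin M y) (embed (U.T + M) (U.history M y)) = 0 := by
  rw [U.energy_Hin M hN, history_zero]
  refine Finset.sum_eq_zero fun z _ => ?_
  by_cases h : z = y
  · subst h
    have : ∀ i, z i ≠ 1 - z i := by
      intro i
      generalize z i = a
      revert a; decide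
    simp [this]
  · simp [h]

theorem energy_Hout_embed (hN : 0 < U.T + M) (φ : ℕ → (Fin m → Fin 2) → ℂ) :
    energy (U.Hout M) (embed (U.T + M) φ) =
      ∑ z, (if z U.out = 0 then (1 : ℝ) else 0) * ‖φ (U.T + M) z‖ ^ 2 := by
  rw [Hout, (isLegalUnit_last hN).energy_embed le_rfl le_rfl, ketbra_self_eq_diagonal,
    onQubit_diagonal]
  have := energy_diagonal (fun z : Fin m → Fin 2 => if z U.out = 0 then (1 : ℝ) else 0)
    (φ (U.T + M))
  simpa only [energy, apply_ite Complex.ofReal, Complex.ofReal_one, Complex.ofReal_zero] using this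

theorem energy_Hout_nonneg (hN : 0 < U.T + M)
    (ψ : (Fin m → Fin 2) × (Fin (U.T + M) → Fin 2) → ℂ) : 0 ≤ energy (U.Hout M) ψ := by
  have h : U.Hout M = diagonal fun p => (((if p.1 U.out = 0 then 1 else 0) *
      (if p.2 ⟨U.T + M - 1, by omega⟩ = 1 then 1 else 0) : ℝ) : ℂ) := by
    rw [Hout, onClock_ketbra_self _ _ ⟨by omega, le_rfl⟩, ketbra_self_eq_diagonal,
      onQubit_diagonal, diagonal_kronecker_diagonal]
    congr 1
    funext p
    simp only [Complex.ofReal_mul, apply_ite Complex.ofReal, Complex.ofReal_one,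
      Complex.ofReal_zero]
  rw [h, energy_diagonal]
  exact Finset.sum_nonneg fun p _ => by positivity

/-- The energy of one clock constraint is the weight of the strings that violate it. -/
theorem energy_clockPair {κ : Type*} [Fintype κ] [DecidableEq κ] {N j : ℕ} (h1 : 1 ≤ j)
    (h2 : j + 1 ≤ N) (ψ : κ × (Fin N → Fin 2) → ℂ) :
    energy ((1 : Matrix κ κ ℂ) ⊗ₖ clockPair N 0 1 0 1 j (j + 1)) ψ =
      ∑ p, (if p.2 ⟨j - 1, by omega⟩ = 0 ∧ p.2 ⟨j, by omega⟩ = 1 then (1 : ℝ) else 0)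
        * ‖ψ p‖ ^ 2 := by
  rw [← energy_diagonal]
  congr 1
  ext ⟨z, c⟩ ⟨z', c'⟩
  rw [kroneckerMap_apply, clockPair_apply h1 (by omega) h2]
  by_cases hz : z = z'
  · by_cases hc : c = c'
    · subst hz hc
      simp [apply_ite Complex.ofReal]
    · rw [diagonal_apply_ne _ (by simp [hc]), if_neg, mul_zero]
      rintro ⟨h, ⟨h3, h4⟩, h5, h6⟩
      refine hc (funext fun q => ?_)
      by_cases hq : q.val = j - 1
      · rw [show q = ⟨j - 1, by omega⟩ from Fin.ext hq]
        exact h3.trans h4.symm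
      · by_cases hq' : q.val = j + 1 - 1
        · rw [show q = ⟨j + 1 - 1, by omega⟩ from Fin.ext hq']
          exact h5.trans h6.symm
        · exact h q hq hq'
  · rw [diagonal_apply_ne _ (by simp [hz]), one_apply_ne hz, zero_mul]

/-- `H_clock` is diagonal and counts occurrences of `01`; every string that is not unary has at
least one. -/
theorem energy_Hclock_ge (ψ : (Fin m → Fin 2) × (Fin (U.T + M) → Fin 2) → ℂ) :
    sqNorm (ψ - embed (U.T + M) (legalPart ψ)) ≤ energy (U.Hclock M) ψ := by
  rw [Hclock, energy_sum]
  set F : ℕ → (Fin m → Fin 2) × (Fin (U.T + M) → Fin 2) → ℝ := fun j p =>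
    if h : 1 ≤ j ∧ j + 1 ≤ U.T + M then
      (if p.2 ⟨j - 1, by omega⟩ = 0 ∧ p.2 ⟨j, by omega⟩ = 1 then (1 : ℝ) else 0) else 0
  have hF0 : ∀ j p, 0 ≤ F j p := by
    intro j p
    simp only [F]
    split_ifs <;> norm_num
  have hF : ∀ j ∈ Finset.Icc 1 (U.T + M - 1),
      energy ((1 : QubitOp m) ⊗ₖ clockPair (U.T + M) 0 1 0 1 j (j + 1)) ψ =
        ∑ p, F j p * ‖ψ p‖ ^ 2 := by
    intro j hj
    rw [Finset.mem_Icc] at hj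
    rw [energy_clockPair hj.1 (by omega)]
    refine Finset.sum_congr rfl fun p _ => ?_
    simp only [F, dif_pos (show 1 ≤ j ∧ j + 1 ≤ U.T + M by omega)]
  rw [Finset.sum_congr rfl hF, Finset.sum_comm]
  refine Finset.sum_le_sum fun p _ => ?_
  rw [← Finset.sum_mul, Pi.sub_apply]
  have hs : 0 ≤ ∑ j ∈ Finset.Icc 1 (U.T + M - 1), F j p := Finset.sum_nonneg fun j _ => hF0 j p
  rcases embed_legalPart_apply ψ p with ⟨h, -⟩ | ⟨h, hp⟩
  · rw [h, sub_self, norm_zero, zero_pow two_ne_zero]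
    exact mul_nonneg hs (sq_nonneg _)
  · rw [h, sub_zero]
    refine le_mul_of_one_le_left (sq_nonneg _) ?_
    by_contra hlt
    refine hp (exists_eq_legal fun q hq hv => hlt ?_)
    have h1 : F (q + 1) p = 1 := by
      simp only [F]
      rw [dif_pos (by omega)]
      exact if_pos hv
    rw [← h1]
    exact Finset.single_le_sum (f := fun j => F j p) (fun j _ => hF0 j p)
      (by rw [Finset.mem_Icc]; omega)

theorem energy_Hclock_embed (φ : ℕ → (Fin m → Fin 2) → ℂ) :
    energy (U.Hclock M) (embed (U.T + M) φ) = 0 := by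
  rw [Hclock, energy_sum]
  refine Finset.sum_eq_zero fun j hj => ?_
  rw [Finset.mem_Icc] at hj
  rw [energy_clockPair hj.1 (by omega)]
  refine Finset.sum_eq_zero fun p _ => ?_
  split_ifs with h
  · have : embed (U.T + M) φ p = 0 := by
      refine Finset.sum_eq_zero fun t _ => if_neg fun ht => ?_
      rw [ht] at h
      have h1 := legal_eq_zero_iff.mp h.1
      have h2 := legal_eq_one_iff.mp h.2
      simp only at h1 h2
      omega
    simp [this]
  · simp

end

end Circuit

end TwoLocal

/-! ### Lower bounds for the energy off the history and for the operator norms. -/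

namespace TwoLocal

open Matrix

theorem energy_le_opNorm {ι : Type*} [Fintype ι] [DecidableEq ι] (A : Matrix ι ι ℂ) (v : ι → ℂ) :
    energy A v ≤ opNorm A * sqNorm v := by
  rw [sqNorm_eq_norm, sq]
  exact (Complex.re_le_norm _).trans (norm_dotProduct_mulVec_le A v v)

theorem sqNorm_embed_of_localized {κ : Type*} [Fintype κ] {N s : ℕ} (hs : s ≤ N)
    {φ : ℕ → κ → ℂ} (hφ : ∀ t, t ≠ s → φ t = 0) : sqNorm (embed N φ) = sqNorm (φ s) := by
  rw [sqNorm_embed, Finset.sum_eq_single s]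
  · intro t _ ht
    simp [hφ t ht, sqNorm]
  · intro h; exact absurd (Finset.mem_range.mpr (by omega)) h

namespace Circuit

variable {m : ℕ} (U : Circuit m) (M : ℕ)

theorem sum_defect_eq (hM : 0 < M) (φ : ℕ → (Fin m → Fin 2) → ℂ) :
    ∑ s ∈ Finset.range (U.T + M), U.defect M φ (s + 1) =
      ∑ t ∈ U.singleTimes M, U.defect M φ t
        + ∑ l ∈ Finset.Icc 1 U.T₂, U.defect M φ (l * U.L + M) := by
  have h3 := U.three_le_L
  have hsub : (Finset.Icc 1 U.T₂).image (fun l => l * U.L + M) ⊆ Finset.Icc 1 (U.T + M) := by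
    intro t ht
    obtain ⟨l, hl, rfl⟩ := Finset.mem_image.mp ht
    have := U.mul_L_le hl
    rw [Finset.mem_Icc]
    omega
  have himg : ∑ t ∈ (Finset.Icc 1 U.T₂).image (fun l => l * U.L + M), U.defect M φ t =
      ∑ l ∈ Finset.Icc 1 U.T₂, U.defect M φ (l * U.L + M) := by
    refine Finset.sum_image fun a _ b _ hab => ?_
    exact Nat.eq_of_mul_eq_mul_right (by omega : 0 < U.L) (by simpa using hab)
  rw [← himg, singleTimes, Finset.sum_sdiff hsub, Finset.range_eq_Ico,
    Finset.sum_Ico_add' (fun t => U.defect M φ t) 0 (U.T + M) 1]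
  rfl

/-- On legal states orthogonal to the history of `y`, the propagation and input terms have a large
energy. -/
theorem energy_legal_ge (hM : 0 < M) (y : Fin m → Fin 2) {Δ Jin J₂ J₁ : ℝ} (hΔ : 0 ≤ Δ)
    (hin : (2 * (U.T + M : ℕ) + 2) * Δ ≤ Jin)
    (h1 : 8 * (U.T + M : ℕ) * ((U.T + M : ℕ) + 1) * Δ ≤ J₁)
    (h2 : 0 < U.T₂ → 0 < J₂ ∧ 4 * (U.T + M : ℕ) * ((U.T + M : ℕ) + 1) * Δ ≤ J₂ ∧
      160 * J₂ ^ 2 * ((U.T + M : ℕ) : ℝ) ^ 2 ≤ J₁)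
    (φ : ℕ → (Fin m → Fin 2) → ℂ)
    (h0 : ∑ t ∈ Finset.range (U.T + M + 1), U.pullBack M φ t y = 0) :
    Δ * sqNorm (embed (U.T + M) φ) - sqNorm (embed (U.T + M) φ) / 2 ≤
      Jin * energy (U.Hin M y) (embed (U.T + M) φ) + J₂ * energy (U.Hprop2 M) (embed (U.T + M) φ)
        + J₁ * energy (U.Hprop1 M) (embed (U.T + M) φ) := by
  set N := U.T + M with hN
  have hN1 : (1 : ℝ) ≤ (N : ℕ) := by exact_mod_cast (by omega : 1 ≤ N)
  set n := sqNorm (embed N φ) with hn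
  have hn0 : 0 ≤ n := sqNorm_nonneg _
  set A := ∑ t ∈ U.singleTimes M, U.defect M φ t with hA
  have hA0 : 0 ≤ A := Finset.sum_nonneg fun t _ => U.defect_nonneg M φ t
  set B := ∑ l ∈ Finset.Icc 1 U.T₂, U.defect M φ (l * U.L + M) with hB
  have hB0 : 0 ≤ B := Finset.sum_nonneg fun t _ => U.defect_nonneg M φ _
  have hJin : 0 ≤ Jin := le_trans (by positivity) hin
  -- The path stiffness is taken to be exactly `2 * N * (N + 1) * Δ`; `J₁` must supply it on the
  -- single-qubit steps and `J₂` on the `CZ` steps.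
  have path := path_gap (U.pullBack M φ) N y hΔ hin le_rfl h0
  simp only [sqNorm_pullBack_sub, sqNorm_pullBack] at path
  rw [← sqNorm_embed, ← hn, U.sum_defect_eq M hM, ← hA, ← hB] at path
  have e0 : U.pullBack M φ 0 = φ 0 := by simp [pullBack, prefixGate]
  rw [e0] at path
  have hi := mul_le_mul_of_nonneg_left (U.energy_Hin_ge M (by omega) y φ) hJin
  rw [U.energy_Hprop1 M, ← hA]
  -- `H_prop1` supplies `J₁ / 2 * A`: half of it pays for the path, the other half for the errors of
  -- the `CZ` terms.
  have hK1 : 2 * N * (N + 1) * Δ * A ≤ J₁ / 4 * A :=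
    mul_le_mul_of_nonneg_right (by linarith) hA0
  have hprop2 : 2 * N * (N + 1) * Δ * B - n / 2 - J₁ / 4 * A ≤
      J₂ * energy (U.Hprop2 M) (embed N φ) := by
    -- Without `CZ` gates there is no lower bound on `J₂`, and none is needed.
    rcases Nat.eq_zero_or_pos U.T₂ with hT | hT
    · have e1 : B = 0 := by simp [hB, hT]
      have e2 : energy (U.Hprop2 M) (embed N φ) = 0 :=
        (U.energy_Hprop2 M φ).trans (by simp [hT])
      have hJ1 : 0 ≤ J₁ := le_trans (by positivity) h1
      rw [e1, e2]
      have : 0 ≤ J₁ / 4 * A := by positivity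
      linarith
    · obtain ⟨hJ2, hJ2', hJ12⟩ := h2 hT
      -- With `Λ = 2 * J₂ * N` the norm errors of the at most `N` gates `CZ` add up to at most `n /
      -- 2`; the defect errors then require `160 * J₂ ^ 2 * N ^ 2 ≤ J₁`.
      have hΛ : 0 < 2 * J₂ * N := by positivity
      have hsum : B / 2 - U.T₂ * (1 / (2 * J₂ * N) * n) - U.T₂ * (20 * (2 * J₂ * N) * A) ≤
          energy (U.Hprop2 M) (embed N φ) := by
        rw [energy_Hprop2]
        refine le_trans (le_of_eq ?_)
          (Finset.sum_le_sum fun l hl => U.energy_cz_ge M hl hM φ hΛ)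
        rw [Finset.sum_sub_distrib, Finset.sum_sub_distrib, ← Finset.sum_div]
        simp only [Finset.sum_const, Nat.card_Icc, nsmul_eq_mul, Nat.add_sub_cancel]
        rfl
      have hT2 : (U.T₂ : ℝ) ≤ N := by
        have h3 := U.three_le_L
        have := U.le_T hT
        have := Nat.le_mul_of_pos_right U.T₂ (by omega : 0 < U.L)
        exact_mod_cast (by omega : U.T₂ ≤ N)
      have g := mul_le_mul_of_nonneg_left hsum hJ2.le
      have g1 : J₂ * (U.T₂ * (1 / (2 * J₂ * N) * n)) ≤ n / 2 := by
        have e : J₂ * (U.T₂ * (1 / (2 * J₂ * N) * n)) = U.T₂ / N * (n / 2) := by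
          field_simp
        rw [e]
        exact mul_le_of_le_one_left (by positivity) ((div_le_one (by positivity)).mpr hT2)
      have g2 : J₂ * (U.T₂ * (20 * (2 * J₂ * N) * A)) ≤ J₁ / 4 * A := by
        calc _ ≤ J₂ * (N * (20 * (2 * J₂ * N) * A)) := by gcongr
          _ = (160 * J₂ ^ 2 * (N : ℝ) ^ 2) / 4 * A := by ring
          _ ≤ _ := by gcongr
      have g3 : 2 * N * (N + 1) * Δ * B ≤ J₂ / 2 * B :=
        mul_le_mul_of_nonneg_right (by linarith) hB0
      linarith
  linarith

/-- The state of energy tests: the basis state `z` at clock time `s`. -/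
theorem exists_test_state (z : Fin m → Fin 2) {s : ℕ} (hs : s ≤ U.T + M) :
    ∃ φ : ℕ → (Fin m → Fin 2) → ℂ, φ s = Pi.single z 1 ∧ (∀ t, t ≠ s → φ t = 0) ∧
      ∀ A : JointOp m (U.T + M), energy A (embed (U.T + M) φ) ≤ opNorm A := by
  refine ⟨fun t => if t = s then Pi.single z 1 else 0, if_pos rfl, fun t ht => if_neg ht,
    fun A => ?_⟩
  have h := energy_le_opNorm A (embed (U.T + M) fun t => if t = s then Pi.single z 1 else 0)
  rwa [sqNorm_embed_of_localized hs (fun t ht => if_neg ht), if_pos rfl, sqNorm_single,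
    mul_one] at h

theorem one_le_opNorm_Hout (hM : 0 < M) : 1 ≤ opNorm (U.Hout M) := by
  obtain ⟨φ, h1, -, h⟩ := U.exists_test_state M 0 le_rfl
  refine le_trans (le_of_eq ?_) (h (U.Hout M))
  rw [U.energy_Hout_embed M (by omega), h1, Finset.sum_eq_single 0] <;> simp +contextual

/-- Tested on the basis state with every bit of `y` flipped, at clock time zero. `H_prop2` cannot
lower this energy, since it is nonnegative on states at a single time. -/
theorem Jin_le_opNorm (hM : 0 < M) (y : Fin m → Fin 2) {Jin J₂ : ℝ} (hJin : 0 ≤ Jin)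
    (hJ2 : 0 ≤ J₂) : Jin ≤ opNorm (U.Hout M + Jin • U.Hin M y + J₂ • U.Hprop2 M) := by
  obtain ⟨φ, h1, h0, h⟩ := U.exists_test_state M (fun i => 1 - y i) (Nat.zero_le _)
  refine le_trans ?_ (h _)
  rw [energy_add, energy_add, energy_smul, energy_smul]
  have e1 := U.energy_Hout_nonneg M (by omega) (embed (U.T + M) φ)
  have e2 : 1 ≤ energy (U.Hin M y) (embed (U.T + M) φ) := by
    refine le_trans ?_ (U.energy_Hin_ge M (by omega) y φ)
    have hne : (fun i => 1 - y i) ≠ y := by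
      intro hy
      have : 1 - y U.out = y U.out := congrFun hy U.out
      generalize y U.out = b at this
      revert b; decide
    refine le_trans (le_of_eq ?_) (Finset.single_le_sum
      (f := fun z => if z = y then 0 else ‖φ 0 z‖ ^ 2)
      (fun z _ => by split_ifs <;> positivity) (Finset.mem_univ fun i => 1 - y i))
    simp [hne, h1]
  have e3 : 0 ≤ energy (U.Hprop2 M) (embed (U.T + M) φ) :=
    le_trans (div_nonneg (Finset.sum_nonneg fun _ _ => sqNorm_nonneg _) (by norm_num))
      (U.energy_Hprop2_ge_of_localized M hM h0)
  have := mul_le_mul_of_nonneg_left e2 hJin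
  have := mul_nonneg hJ2 e3
  linarith

/-- Tested at the time of the first `CZ` gate, where `H_time` contains a projector with coefficient
`1 / 8`. -/
theorem J₂_le_opNorm (hM : 0 < M) (hT : 0 < U.T₂) (y : Fin m → Fin 2) {Jin J₂ : ℝ}
    (hJin : 0 ≤ Jin) (hJ2 : 0 ≤ J₂) :
    J₂ ≤ 8 * opNorm (U.Hout M + Jin • U.Hin M y + J₂ • U.Hprop2 M) := by
  have h1T : 1 ∈ Finset.Icc 1 U.T₂ := Finset.mem_Icc.mpr ⟨le_rfl, hT⟩
  have hLT := U.mul_L_le h1T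
  obtain ⟨φ, h1, h0, h⟩ := U.exists_test_state M 0 (s := 1 * U.L + M) (by omega)
  have h := h (U.Hout M + Jin • U.Hin M y + J₂ • U.Hprop2 M)
  rw [energy_add, energy_add, energy_smul, energy_smul] at h
  have e1 := U.energy_Hout_nonneg M (by omega) (embed (U.T + M) φ)
  have e2 := U.energy_Hin_nonneg M (by omega) y φ
  have e3 := U.energy_Hprop2_ge_of_localized M hM h0
  have e4 := Finset.single_le_sum (f := fun l => sqNorm (φ (l * U.L + M)))
    (fun _ _ => sqNorm_nonneg _) h1T
  simp only [h1, sqNorm_single] at e4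
  have e5 : J₂ * (1 / 8) ≤ J₂ * energy (U.Hprop2 M) (embed (U.T + M) φ) :=
    mul_le_mul_of_nonneg_left (by linarith) hJ2
  have := mul_nonneg hJin e2
  linarith

theorem energy_hamiltonian (y : Fin m → Fin 2) (Jin Jclock J₁ J₂ : ℝ)
    (ψ : (Fin m → Fin 2) × (Fin (U.T + M) → Fin 2) → ℂ) :
    energy (U.hamiltonian M y Jin Jclock J₁ J₂) ψ =
      Jin * energy (U.Hin M y) ψ + Jclock * energy (U.Hclock M) ψ + J₁ * energy (U.Hprop1 M) ψ
        + J₂ * energy (U.Hprop2 M) ψ + (U.T + M : ℕ) * energy (U.Hout M) ψ := by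
  simp only [hamiltonian, energy_add, energy_smul]

theorem energy_history_le (hM : 0 < M) (y : Fin m → Fin 2) (Jin Jclock J₁ J₂ : ℝ) :
    energy (U.hamiltonian M y Jin Jclock J₁ J₂) (embed (U.T + M) (U.history M y)) ≤
      1 * sqNorm (embed (U.T + M) (U.history M y)) := by
  have hout : energy (U.Hout M) (embed (U.T + M) (U.history M y)) ≤ 1 := by
    rw [U.energy_Hout_embed M (by omega)]
    refine le_trans (Finset.sum_le_sum fun z _ => mul_le_of_le_one_left (sq_nonneg _) ?_)
      (U.sqNorm_history M y (U.T + M)).le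
    split_ifs <;> norm_num
  have hp : energy (U.Hprop1 M) (embed (U.T + M) (U.history M y)) = 0 := by
    rw [energy_Hprop1, Finset.sum_eq_zero, zero_div]
    exact fun t ht => U.defect_history M y ((U.mem_singleTimes M).mp ht).1.1
  have hs : sqNorm (embed (U.T + M) (U.history M y)) = (U.T + M : ℕ) + 1 := by
    simp [sqNorm_embed, sqNorm_history]
  rw [energy_hamiltonian, U.energy_Hin_history M (by omega), U.energy_Hclock_embed M, hp,
    U.energy_Hprop2_history M hM, hs]
  have := mul_le_mul_of_nonneg_left hout (Nat.cast_nonneg (α := ℝ) (U.T + M))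
  linarith

theorem energy_ge_of_orthogonal_history (hM : 0 < M) (y : Fin m → Fin 2)
    {Δ Jin J₂ J₁ Jclock c : ℝ} (hΔ : 0 ≤ Δ)
    (hin : (2 * (U.T + M : ℕ) + 2) * Δ ≤ Jin)
    (h1 : 8 * (U.T + M : ℕ) * ((U.T + M : ℕ) + 1) * Δ ≤ J₁)
    (h2 : 0 < U.T₂ → 0 < J₂ ∧ 4 * (U.T + M : ℕ) * ((U.T + M : ℕ) + 1) * Δ ≤ J₂ ∧
      160 * J₂ ^ 2 * ((U.T + M : ℕ) : ℝ) ^ 2 ≤ J₁)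
    (hc : c = opNorm (U.Hout M + Jin • U.Hin M y + J₂ • U.Hprop2 M + J₁ • U.Hprop1 M))
    (hclock : Δ + c + 2 * c ^ 2 ≤ Jclock)
    (ψ : (Fin m → Fin 2) × (Fin (U.T + M) → Fin 2) → ℂ)
    (h0 : star (embed (U.T + M) (U.history M y)) ⬝ᵥ ψ = 0) :
    (Δ - 1) * sqNorm ψ ≤ energy (U.hamiltonian M y Jin Jclock J₁ J₂) ψ := by
  set B := U.Hout M + Jin • U.Hin M y + J₂ • U.Hprop2 M + J₁ • U.Hprop1 M with hB
  have hout : (U.Hout M).IsHermitian := by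
    simp [IsHermitian, Hout, conjTranspose_kronecker, onQubit_conjTranspose,
      onClock_conjTranspose, ketbra_conjTranspose]
  have hBh : B.IsHermitian := by
    -- `B` contains `H_out` with coefficient one, as in the norm that bounds `Jclock`; the remaining
    -- `N - 1` copies are nonnegative and are dropped in `ho3`.
    have e : B = U.hamiltonian M y Jin 0 J₁ J₂ - (((U.T + M : ℕ) : ℝ) - 1) • U.Hout M := by
      rw [hB, hamiltonian]
      module
    rw [e]
    refine (U.hamiltonian_isHermitian M y Jin 0 J₁ J₂).sub ?_
    simp [IsHermitian, conjTranspose_smul, hout.eq]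
  set φ := legalPart ψ
  have horth : ∑ t ∈ Finset.range (U.T + M + 1), U.pullBack M φ t y = 0 := by
    rw [← h0, star_embed_dotProduct]
    exact Finset.sum_congr rfl fun t _ => (U.star_history_dotProduct M y φ t).symm
  have hlegal := U.energy_legal_ge M hM y hΔ hin h1 h2 φ horth
  have hpert := energy_add_vec_ge hBh (embed (U.T + M) φ) (ψ - embed (U.T + M) φ)
  rw [add_sub_cancel, ← hc] at hpert
  have hBe : ∀ v, energy B v = energy (U.Hout M) v + Jin * energy (U.Hin M y) v
      + J₂ * energy (U.Hprop2 M) v + J₁ * energy (U.Hprop1 M) v := fun v => by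
    simp only [hB, energy_add, energy_smul]
  rw [hBe, hBe] at hpert
  have hH : energy (U.hamiltonian M y Jin Jclock J₁ J₂) ψ = _ :=
    U.energy_hamiltonian M y Jin Jclock J₁ J₂ ψ
  have hsplit := sqNorm_eq_legal_add ψ
  have hw := sqNorm_nonneg (ψ - embed (U.T + M) φ)
  have ho1 := U.energy_Hout_nonneg M (by omega) ψ
  have ho2 := U.energy_Hout_nonneg M (by omega) (embed (U.T + M) φ)
  have hN1 : (1 : ℝ) ≤ (U.T + M : ℕ) := by exact_mod_cast (by omega : 1 ≤ U.T + M)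
  have ho3 : energy (U.Hout M) ψ ≤ (U.T + M : ℕ) * energy (U.Hout M) ψ :=
    le_mul_of_one_le_left ho1 hN1
  have hc0 : 0 ≤ c := hc ▸ opNorm_nonneg _
  have hJc : 0 ≤ Jclock := le_trans (by positivity) hclock
  have hcl := mul_le_mul_of_nonneg_left (U.energy_Hclock_ge M ψ) hJc
  have hcl2 := mul_le_mul_of_nonneg_right hclock hw
  rw [hH, hsplit]
  linarith

end Circuit

end TwoLocal

/-! ### The polynomials and the final estimate. -/

open Polynomial in
theorem mainTheorem8 :
    ∃ pIn p₂ p₁ pClock : Polynomial ℝ,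
      ∀ (n r : ℕ) (U : TwoLocal.Circuit (n + r)) (x : Fin n → Fin 2) (M : ℕ), U.L < M →
      ∀ (Δ Jin J₂ J₁ Jclock : ℝ),
        pIn.eval (TwoLocal.opNorm (U.Hout M) * ((U.T : ℝ) + (M : ℝ))) * Δ ≤ Jin →
        p₂.eval (TwoLocal.opNorm
            (U.Hout M + Jin • U.Hin M (TwoLocal.initialBits r x)) * (U.T : ℝ)) * Δ ≤ J₂ →
        p₁.eval (TwoLocal.opNorm
            (U.Hout M + Jin • U.Hin M (TwoLocal.initialBits r x) + J₂ • U.Hprop2 M)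
              * (M : ℝ)) * Δ ≤ J₁ →
        pClock.eval (TwoLocal.opNorm
            (U.Hout M + Jin • U.Hin M (TwoLocal.initialBits r x) + J₂ • U.Hprop2 M
              + J₁ • U.Hprop1 M)) * Δ ≤ Jclock →
        Δ - 2 ≤ TwoLocal.spectralGap
          (U.hamiltonian_isHermitian M (TwoLocal.initialBits r x) Jin Jclock J₁ J₂) := by
  -- The first two give the bounds on `Jin` and `J₂` needed for the path. In the third, `10240 = 160
  -- * 8 ^ 2` comes from `J₂ ≤ 8 * b` and `N ≤ b`, and `X ^ 2` covers the path. The last is the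
  -- perturbation bound for the illegal part.
  refine ⟨2 * X + 2, X ^ 2, 10240 * X ^ 4 + X ^ 2, 1 + X + 2 * X ^ 2, ?_⟩
  intro n r U x M hLM Δ Jin J₂ J₁ Jclock hin h2 h1 hclock
  simp only [eval_add, eval_mul, eval_pow, eval_X, eval_ofNat, eval_one] at hin h2 h1 hclock
  generalize TwoLocal.initialBits r x = y at *
  have hM : 0 < M := by omega
  have hcard : 1 < Fintype.card ((Fin (n + r) → Fin 2) × (Fin (U.T + M) → Fin 2)) := by
    have := Nat.one_lt_two_pow (n := U.T + M) (by omega)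
    simp only [Fintype.card_prod, Fintype.card_fun, Fintype.card_fin]
    exact this.trans_le (Nat.le_mul_of_pos_left _ (by positivity))
  -- For `Δ ≤ 2` the claim only says that the gap is nonnegative; `Δ > 2` makes the couplings large
  -- compared with `N`.
  rcases le_or_gt Δ 2 with hΔ | hΔ
  · have := TwoLocal.spectralGap_nonneg
      (U.hamiltonian_isHermitian M y Jin Jclock J₁ J₂) hcard
    linarith
  have hΔ0 : 0 ≤ Δ := by linarith
  set N := U.T + M with hN
  have hNc : ((N : ℕ) : ℝ) = U.T + M := by push_cast [hN]; rfl
  have hN1 : (1 : ℝ) ≤ N := by exact_mod_cast (by omega : 1 ≤ N)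
  have hJin : (2 * (N : ℝ) + 2) * Δ ≤ Jin := by
    refine le_trans (mul_le_mul_of_nonneg_right ?_ hΔ0) hin
    have := le_mul_of_one_le_left (Nat.cast_nonneg (α := ℝ) N) (U.one_le_opNorm_Hout M hM)
    rw [← hNc]
    linarith
  have hJinN : 4 * ((N : ℝ) + 1) ≤ Jin := by nlinarith
  have hJin0 : 0 ≤ Jin := by linarith
  have hJ20 : 0 ≤ J₂ := le_trans (by positivity) h2
  set b := TwoLocal.opNorm (U.Hout M + Jin • U.Hin M y + J₂ • U.Hprop2 M)
  have hb : Jin ≤ b := U.Jin_le_opNorm M hM y hJin0 hJ20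
  have hJb : 0 < U.T₂ → J₂ ≤ 8 * b := fun hT => U.J₂_le_opNorm M hM hT y hJin0 hJ20
  clear_value b
  have hb0 : 0 ≤ b := hJin0.trans hb
  have hbM : b ≤ b * M := le_mul_of_one_le_right hb0 (by exact_mod_cast hM)
  have hJ1 : (10240 * b ^ 4 + b ^ 2) * Δ ≤ J₁ := by
    refine le_trans ?_ h1
    gcongr
  have hb2 : 16 * ((N : ℝ) + 1) ^ 2 ≤ b ^ 2 := by
    calc 16 * ((N : ℝ) + 1) ^ 2 = (4 * ((N : ℝ) + 1)) ^ 2 := by ring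
      _ ≤ _ := by gcongr; linarith
  have hJ1' : 8 * (N : ℝ) * (N + 1) * Δ ≤ J₁ := by
    refine le_trans (mul_le_mul_of_nonneg_right ?_ hΔ0) hJ1
    have : 0 ≤ 10240 * b ^ 4 := by positivity
    nlinarith
  have hJ2 : 0 < U.T₂ → 0 < J₂ ∧ 4 * (N : ℝ) * (N + 1) * Δ ≤ J₂ ∧
      160 * J₂ ^ 2 * (N : ℝ) ^ 2 ≤ J₁ := by
    intro hT
    have hT1 : (1 : ℝ) ≤ U.T := by
      have := U.le_T hT
      exact_mod_cast (by omega : 1 ≤ U.T)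
    have ha : Jin ≤ TwoLocal.opNorm (U.Hout M + Jin • U.Hin M y) := by
      have := U.Jin_le_opNorm M hM y hJin0 le_rfl
      rwa [zero_smul, add_zero] at this
    -- The argument of the polynomial for `J₂` involves `T` and not `N`, but the norm is at least
    -- `Jin`, which already exceeds `N`.
    have haT : 4 * ((N : ℝ) + 1) ≤ TwoLocal.opNorm (U.Hout M + Jin • U.Hin M y) * U.T :=
      (hJinN.trans ha).trans (le_mul_of_one_le_right (hJin0.trans ha) hT1)
    have ha2 : (4 * ((N : ℝ) + 1)) ^ 2 * Δ ≤ J₂ := by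
      refine le_trans ?_ h2
      gcongr
    have hlow : 4 * (N : ℝ) * (N + 1) * Δ ≤ J₂ := by
      refine le_trans (mul_le_mul_of_nonneg_right ?_ hΔ0) ha2
      nlinarith
    refine ⟨lt_of_lt_of_le (by positivity) hlow, hlow, ?_⟩
    have hJb := hJb hT
    have hNb : (N : ℝ) ≤ b := by linarith
    calc 160 * J₂ ^ 2 * (N : ℝ) ^ 2 ≤ 160 * (8 * b) ^ 2 * b ^ 2 := by gcongr
      _ = 10240 * b ^ 4 * 1 := by ring
      _ ≤ (10240 * b ^ 4 + b ^ 2) * Δ :=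
        mul_le_mul (le_add_of_nonneg_right (sq_nonneg b)) (by linarith) zero_le_one (by positivity)
      _ ≤ J₁ := hJ1
  set c := TwoLocal.opNorm
    (U.Hout M + Jin • U.Hin M y + J₂ • U.Hprop2 M + J₁ • U.Hprop1 M) with hc
  have hc0 : 0 ≤ c := TwoLocal.opNorm_nonneg _
  clear_value c
  have hcl : Δ + c + 2 * c ^ 2 ≤ Jclock := by
    refine le_trans ?_ hclock
    nlinarith [sq_nonneg c, mul_nonneg hc0 (by linarith : 0 ≤ Δ - 1),
      mul_nonneg (sq_nonneg c) (by linarith : 0 ≤ Δ - 1)]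
  have key := TwoLocal.le_spectralGap (U.hamiltonian_isHermitian M y Jin Jclock J₁ J₂) hcard
    (a := 1) (b := Δ - 1) (η := TwoLocal.embed N (U.history M y))
    (by
      have : TwoLocal.sqNorm (TwoLocal.embed N (U.history M y)) = (N : ℕ) + 1 := by
        simp [TwoLocal.sqNorm_embed, TwoLocal.Circuit.sqNorm_history]
      rw [this]; positivity)
    (U.energy_history_le M hM y Jin Jclock J₁ J₂)
    (U.energy_ge_of_orthogonal_history M hM y hΔ0 hJin hJ1' hJ2 hc hcl)
  linarith
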